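/- Let $a\ge b\ge -1/2$ be real, $\epsilon=(a+b+1)/2$, and let $u,u'\in\mathbb{C}$ satisfy: $(u-k)(u'-k)>0$ for all integers $k\ge 0$; $(u+k+2\epsilon)(u'+k+2\epsilon)>0$ for all integers $k\ge 1$; and $u+u'+b>-1$ (where $z>0$ means that $z$ is real and positive; $u+u'$ is then real). Let $R=[R(x,y)]_{x,y\in\mathbb{Z}_{\ge0}}$ be the birth-and-death matrix with $R(x,x+1)=\beta(x)$, $R(x,x-1)=\delta(x)$ for $x\ge1$, $R(x,x)=-\beta(x)-\delta(x)$, and all other entries zero, where $$\beta(x)=\frac{(x+2\epsilon)(x+a+1)(x-u)(x-u')}{2(x+\epsilon)(2x+2\epsilon+1)}\ (x\ge 0),\qquad \delta(x)=\frac{x(x+b)(x+u+2\epsilon)(x+u'+2\epsilon)}{2(x+\epsilon)(2x+2\epsilon-1)}\ (x\ge1),\quad \delta(0)=0;$$ for $x=0$ the factor $(x+2\epsilon)/(2(x+\epsilon))$ is read as $1$, also when $\epsilon=0$. Let $N\ge1$ and let $\mathbb{GT}^+_N$ be the (discrete) set of integer tuples $\lambda_1\ge\dots\ge\lambda_N\ge0$.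 For $\lambda,\nu\in\mathbb{GT}^+_N$ put $l_i=\lambda_i+N-i$, $n_i=\nu_i+N-i$, $\widehat{l}_i=(l_i+\epsilon)^2$, $\widehat{n}_i=(n_i+\epsilon)^2$. Let $\Delta_N(x)=\prod_{i<j}(x_i-x_j)$, $c_N=\frac{N(N-1)(N-2)}{3}-\frac{N(N-1)}{2}(u+u'+b)$, and $$R^{(N)}(\lambda,\nu)=\frac{\Delta_N(\widehat n)}{\Delta_N(\widehat l)}\sum_{i=1}^N R(l_i,n_i)\mathbf 1_{\{l_j=n_j\ \forall j\ne i\}}-c_N\mathbf 1_{\{\lambda=\nu\}}.$$ On a countable set $X$, a matrix of transition rates is a real matrix $Q=[q_{i,j}]_{i,j\in X}$ with $q_{i,j}\ge0$ for $i\ne j$ and $\sum_{j\ne i}q_{i,j}=-q_{i,i}=:q_i<\infty$ for all $i$. It is non-explosive if the matrices $\sum_{n\ge0}P^{[n]}(t)$ are stochastic for all $t\ge0$, where $P^{[0]}(t;i,j)=e^{-q_it}\mathbf 1_{\{i=j\}}$ and $P^{[n]}(t;i,j)=\int_0^t e^{-q_is}\sum_{k\ne i}q_{i,k}P^{[n-1]}(t-s;k,j)\,ds$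 for $n\ge1$. A (standard) Markov semigroup on $X$ is a family $(P(t))_{t\ge0}$ of stochastic matrices with $P(0)=I$, $P(s+t)=P(s)P(t)$, and $P(t)\to I$ entrywise as $t\to0^+$; its $q$-matrix is the entrywise limit of $(P(h)-I)/h$ as $h\downarrow0$. It is Feller if each $P(t)$ maps $C_0(X)$ into $C_0(X)$ and $t\mapsto P(t)f$ is continuous from $[0,\infty)$ to $C_0(X)$ for every $f\in C_0(X)$, where $X$ is discrete. Then $R^{(N)}$ is a matrix of transition rates and is non-explosive. There is a unique Markov semigroup $(P_1(t))_{t\ge0}$ on $\mathbb{Z}_{\ge0}$ with $q$-matrix $R$, and a unique Markov semigroup $(P_N(t))_{t\ge0}$ on $\mathbb{GT}^+_N$ with $q$-matrix $R^{(N)}$. The latter is Feller, and for all $t\ge0$ and $\lambda,\nu\in\mathbb{GT}^+_N$ $$P_N(t;\lambda,\nu)=e^{-c_Nt}\,\frac{\Delta_N(\widehat n)}{\Delta_N(\widehat l)}\,\det_{1\le i,j\le N}\bigl[P_1(t;l_i,n_j)\bigr].$$ -/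

import Mathlib

open scoped ENNReal NNReal Topology ZeroAtInfty

noncomputable section

namespace BCGraph

/-! ### Continuous-time Markov semigroups on a countable discrete space

Kernels on a countable discrete space `X` are written as (infinite) matrices `Matrix X X ℝ`. -/

section General

variable {X : Type*} [DecidableEq X]

/-- A matrix of transition rates: nonnegative off-diagonal entries, and every row has a convergent
off-diagonal sum equal to minus the diagonal entry (the matrix is stable and conservative). -/
structure IsRateMatrix (Q : Matrix X X ℝ) : Prop where
  nonneg : ∀ i j, i ≠ j → 0 ≤ Q i j
  conservative : ∀ i, HasSum (fun j : {j : X // j ≠ i} => Q i j) (-Q i i)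

/-- A standard Markov semigroup: stochastic matrices `P t`, `t ≥ 0`, with `P 0 = I`, the
Chapman–Kolmogorov equations, and entrywise continuity at `0`. -/
structure IsMarkovSemigroup (P : ℝ≥0 → Matrix X X ℝ) : Prop where
  nonneg : ∀ t i j, 0 ≤ P t i j
  rowSum : ∀ t i, HasSum (fun j => P t i j) 1
  zero : P 0 = 1
  chapmanKolmogorov : ∀ s t i j, HasSum (fun k => P s i k * P t k j) (P (s + t) i j)
  standard : ∀ i j, Filter.Tendsto (fun t : ℝ≥0 => P t i j) (𝓝[>] 0) (𝓝 ((1 : Matrix X X ℝ) i j))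

/-- `Q` is the `q`-matrix of `P`: entrywise, `Q` is the right derivative of `P` at time `0`. -/
def HasQMatrix (P : ℝ≥0 → Matrix X X ℝ) (Q : Matrix X X ℝ) : Prop :=
  ∀ i j, Filter.Tendsto (fun h : ℝ≥0 => (P h i j - (1 : Matrix X X ℝ) i j) / (h : ℝ))
    (𝓝[>] 0) (𝓝 (Q i j))

/-- `P` is the unique standard Markov semigroup with `q`-matrix `Q`. -/
def IsUniqueSemigroupOf (P : ℝ≥0 → Matrix X X ℝ) (Q : Matrix X X ℝ) : Prop :=
  IsMarkovSemigroup P ∧ HasQMatrix P Q ∧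
    ∀ P' : ℝ≥0 → Matrix X X ℝ, IsMarkovSemigroup P' → HasQMatrix P' Q → P' = P

/-- The matrices `P^{[n]}(t)` given, with `q_i = -Q i i`, by
`P^{[0]}(t; i, j) = e^{-q_i t} 1_{i = j}` and
`P^{[n+1]}(t; i, j) = ∫_0^t e^{-q_i s} ∑_{k ≠ i} q_{i,k} P^{[n]}(t - s; k, j) ds`.
For a matrix of transition rates all the integrands are nonnegative, so that the values may be
taken in `[0, ∞]`. -/
def jumpProb (Q : Matrix X X ℝ) : ℕ → ℝ → X → X → ℝ≥0∞
  | 0, t, i, j => if i = j then ENNReal.ofReal (Real.exp (Q i i * t)) else 0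
  | n + 1, t, i, j =>
      ∫⁻ s in Set.Icc (0 : ℝ) t, ENNReal.ofReal (Real.exp (Q i i * s)) *
        ∑' k : {k : X // k ≠ i}, ENNReal.ofReal (Q i k) * jumpProb Q n (t - s) k j

/-- The minimal solution `∑_n P^{[n]}(t)`. -/
def minimalSolution (Q : Matrix X X ℝ) (t : ℝ) (i j : X) : ℝ≥0∞ :=
  ∑' n : ℕ, jumpProb Q n t i j

/-- `Q` is non-explosive (regular): it is a matrix of transition rates, and all the matrices of its
minimal solution are stochastic. -/
def IsNonExplosive (Q : Matrix X X ℝ) : Prop :=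
  IsRateMatrix Q ∧ ∀ t : ℝ, 0 ≤ t → ∀ i, ∑' j, minimalSolution Q t i j = 1

end General

/-- The Feller property of a family of matrices on a discrete space `X`: `f ↦ P t f` maps `C₀(X)`
into `C₀(X)`, and `t ↦ P t f` is continuous from `[0, ∞)` to `C₀(X)` with the supremum norm. -/
def IsFeller {X : Type*} [TopologicalSpace X] [DiscreteTopology X]
    (P : ℝ≥0 → Matrix X X ℝ) : Prop :=
  ∀ f : C₀(X, ℝ), ∃ F : ℝ≥0 → C₀(X, ℝ), Continuous F ∧
    ∀ t x, HasSum (fun y => P t x y * f y) (F t x)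

/-! ### The birth-and-death matrix -/

/-- `ε = (a + b + 1) / 2`. -/
def eps (a b : ℝ) : ℝ := (a + b + 1) / 2

open scoped ComplexOrder in
/-- The set `ℋ°` of admissible pairs `(u, u')`. For complex `z`, `0 < z` means that `z` is real and
positive. -/
def admissible (a b : ℝ) : Set (ℂ × ℂ) :=
  {p | (∀ k : ℕ, 0 < (p.1 - k) * (p.2 - k)) ∧
    (∀ k : ℕ, 1 ≤ k →
      0 < (p.1 + k + 2 * (eps a b : ℂ)) * (p.2 + k + 2 * (eps a b : ℂ))) ∧
    -1 < p.1 + p.2 + (b : ℂ)}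

/-- The birth rates
`β(x) = (x + 2ε)(x + a + 1)(x - u)(x - u') / (2 (x + ε)(2x + 2ε + 1))`; the product
`(x - u)(x - u')` is real for admissible `(u, u')`. At `x = 0` the factor `(x + 2ε) / (2 (x + ε))`
is cancelled to `1`, so that `β(0)` also has its intended value if `ε = 0`. -/
def birthRate (a b : ℝ) (u u' : ℂ) (x : ℕ) : ℝ :=
  if x = 0 then (a + 1) * (u * u').re / (2 * eps a b + 1)
  else (x + 2 * eps a b) * (x + a + 1) * ((x - u) * (x - u')).re /
    (2 * (x + eps a b) * (2 * x + 2 * eps a b + 1))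

/-- The death rates
`δ(x) = x (x + b)(x + u + 2ε)(x + u' + 2ε) / (2 (x + ε)(2x + 2ε - 1))` for `x ≥ 1`, and
`δ(0) = 0`. -/
def deathRate (a b : ℝ) (u u' : ℂ) (x : ℕ) : ℝ :=
  if x = 0 then 0
  else x * (x + b) * ((x + u + 2 * (eps a b : ℂ)) * (x + u' + 2 * (eps a b : ℂ))).re /
    (2 * (x + eps a b) * (2 * x + 2 * eps a b - 1))

/-- The birth-and-death matrix `R` on `ℤ₊`. -/
def rateMatrix (a b : ℝ) (u u' : ℂ) : Matrix ℕ ℕ ℝ := fun x y =>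
  if y = x + 1 then birthRate a b u u' x
  else if x = y + 1 then deathRate a b u u' x
  else if x = y then -(birthRate a b u u' x + deathRate a b u u' x)
  else 0

/-! ### Positive signatures and the transformed matrix -/

/-- Positive signatures `λ₁ ≥ ⋯ ≥ λ_N ≥ 0`, with the (discrete) subspace topology. -/
abbrev GTPlus (N : ℕ) : Type := {lam : Fin N → ℕ // Antitone lam}

/-- `l_i = λ_i + N - i` for `i = 1, …, N` (the indices of `Fin N` start at `0`). -/
def shifted {N : ℕ} (lam : GTPlus N) (i : Fin N) : ℕ := lam.1 i + (N - 1 - (i : ℕ))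

/-- `\hat l_i = (l_i + ε)²`. -/
def hat (a b : ℝ) {N : ℕ} (lam : GTPlus N) (i : Fin N) : ℝ := (shifted lam i + eps a b) ^ 2

/-- `Δ_N(x) = ∏_{i < j} (x_i - x_j)`. -/
def vdm {N : ℕ} (x : Fin N → ℝ) : ℝ := ∏ i : Fin N, ∏ j ∈ Finset.Ioi i, (x i - x j)

/-- `c_N = N(N-1)(N-2)/3 - N(N-1)/2 · (u + u' + b)`; here `u + u'` is real for admissible pairs. -/
def cConst (b : ℝ) (u u' : ℂ) (N : ℕ) : ℝ :=
  (N : ℝ) * (N - 1) * (N - 2) / 3 - (N : ℝ) * (N - 1) / 2 * ((u + u').re + b)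

/-- The Doob-transformed matrix
`R^{(N)}(λ, ν) = Δ_N(\hat n) / Δ_N(\hat l) · ∑_i R(l_i, n_i) 1_{l_j = n_j, j ≠ i} - c_N 1_{λ = ν}`. -/
def rateMatrixN (a b : ℝ) (u u' : ℂ) (N : ℕ) : Matrix (GTPlus N) (GTPlus N) ℝ := fun lam nu =>
  vdm (hat a b nu) / vdm (hat a b lam) *
      (∑ i : Fin N, if ∀ j, j ≠ i → shifted lam j = shifted nu j
        then rateMatrix a b u u' (shifted lam i) (shifted nu i) else 0)
    - (if lam = nu then cConst b u u' N else 0)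

end BCGraph

end

/-! The matrix R^(N) is the Doob transform, by the Vandermonde Δ_N in the variables (l_i+ε)², of N
independent birth-and-death processes kept in the chamber l_1 > ... > l_N. Two facts carry the
proof.

Algebra. Put y = x+ε. On the Newton basis ∏_{k<m}(y²-(k+ε)²), the one-particle generator is
bidiagonal with eigenvalues m(m-1-(u+u'+b)) (`bdGen_newtonPoly`). It acts on determinants of Newton
polynomials one variable at a time, and lowering a degree usually creates two equal columns. Degrees
N-1,...,0 give Δ_N, an eigenfunction with eigenvalue c_N, so R^(N) is conservative
(`sum_rateMatrixN`). Degrees N,N-2,...,0 show that R^(N) maps ∑(l_i+ε)² to an affine function of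
itself, which yields a proper Lyapunov function (`hasLyapunov_rateMatrixN`). Jumps out of the
chamber are harmless: nearest-neighbour moves leave it only through a collision, where determinants
vanish (`sum_single_coordinate`).

Analysis. A proper Lyapunov function gives a maximum principle, hence uniqueness of locally bounded
solutions of the backward equation (`HasLyapunov.nonpos_of_subsolution`,
`HasLyapunov.eq_of_isBackwardSolution`). Everything else compares two such solutions: the total mass
of the minimal solution with 1 (non-explosion), two semigroups with the same q-matrix (uniqueness),
and P_N with the determinantal kernel (the formula).

For the Feller property, columns must vanish at infinity locally uniformly in time. For one
particle, 1/((x+ε)²+1) is a supersolution up to an exponential factor (`exists_bdGen_inv_le`); the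
determinantal formula, with Δ_N ≥ 1, transfers this decay to N particles. -/

namespace BCGraph

/-! ### Lyapunov functions and the maximum principle -/

/-- A conservative matrix of transition rates with finite rows, the row `i` being supported in
`S i`, together with a proper Lyapunov function `F`. -/
structure HasLyapunov {X : Type*} (Q : Matrix X X ℝ) (S : X → Finset X) (F : X → ℝ) (C : ℝ) :
    Prop where
  nonneg : ∀ i j, i ≠ j → 0 ≤ Q i j
  support : ∀ i j, j ∉ S i → Q i j = 0
  conservative : ∀ i, ∑ j ∈ S i, Q i j = 0
  one_le : ∀ i, 1 ≤ F i
  proper : ∀ c, {i | F i ≤ c}.Finite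
  bound : ∀ i, ∑ j ∈ S i, Q i j * F j ≤ C * F i

/-- A family of functions solving the backward equation `∂ₜ u = Q u` on `[0, ∞)`. -/
def IsBackwardSolution {X : Type*} (Q : Matrix X X ℝ) (S : X → Finset X) (u : ℝ → X → ℝ) : Prop :=
  ∀ t, 0 ≤ t → ∀ i,
    HasDerivWithinAt (fun s => u s i) (∑ k ∈ S i, Q i k * u t k) (Set.Ici 0) t

/-- Only earlier times are compared, since the maximum over [0, T] may sit at the endpoint T. -/
theorem deriv_nonneg_of_left_max {f : ℝ → ℝ} {f' t : ℝ} (ht : 0 < t) (hf : HasDerivAt f f' t)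
    (hmax : ∀ s, 0 ≤ s → s ≤ t → f s ≤ f t) : 0 ≤ f' := by
  have h1 : Filter.Tendsto (slope f t) (𝓝[<] t) (𝓝 f') :=
    (hasDerivWithinAt_iff_tendsto_slope' (by simp)).1 (hf.hasDerivWithinAt (s := Set.Iio t))
  refine ge_of_tendsto h1 ?_
  filter_upwards [Ioo_mem_nhdsLT ht] with s hs
  rw [slope_def_field]
  exact div_nonneg_of_nonpos (by linarith [hmax s hs.1.le hs.2.le]) (by linarith [hs.2])

namespace HasLyapunov

variable {X : Type*} {Q : Matrix X X ℝ} {S : X → Finset X} {F : X → ℝ} {C : ℝ}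

theorem apply_nonpos_of_max (h : HasLyapunov Q S F C) (v : X → ℝ) (i : X)
    (hv : ∀ k, v k ≤ v i) : ∑ k ∈ S i, Q i k * v k ≤ 0 := by
  have h1 : ∑ k ∈ S i, Q i k * v k = ∑ k ∈ S i, Q i k * (v k - v i) := by
    simp only [mul_sub, Finset.sum_sub_distrib, ← Finset.sum_mul, h.conservative, zero_mul,
      sub_zero]
  rw [h1]
  refine Finset.sum_nonpos fun k _ => ?_
  by_cases hk : k = i
  · simp [hk]
  · exact mul_nonpos_of_nonneg_of_nonpos (h.nonneg i k (Ne.symm hk)) (by linarith [hv k])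

/-- Maximum principle: a subsolution of the backward equation, bounded above on finite time
intervals and nonpositive at time `0`, is nonpositive. -/
theorem nonpos_of_subsolution (h : HasLyapunov Q S F C) {u d : ℝ → X → ℝ}
    (hu : ∀ t, 0 ≤ t → ∀ i, HasDerivWithinAt (fun s => u s i) (d t i) (Set.Ici 0) t)
    (hd : ∀ t, 0 ≤ t → ∀ i, d t i ≤ ∑ k ∈ S i, Q i k * u t k)
    (h0 : ∀ i, u 0 i ≤ 0)
    (hB : ∀ T, ∃ B, ∀ t, 0 ≤ t → t ≤ T → ∀ i, u t i ≤ B) :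
    ∀ t, 0 ≤ t → ∀ i, u t i ≤ 0 := by
  intro T hT i₀
  obtain ⟨B, hB⟩ := hB T
  -- K ≥ C makes F a supersolution at rate K, and K > 0 makes the final inequality strict at a
  -- positive maximum.
  set K : ℝ := max C 0 + 1 with hK
  have hKC : C ≤ K := by linarith [le_max_left C 0]
  have hK0 : 0 < K := by linarith [le_max_right C 0]
  have key : ∀ η : ℝ, 0 < η → Real.exp (-K * T) * u T i₀ ≤ η * F i₀ := by
    intro η hη
    by_contra hcon
    push Not at hcon
    -- The penalty ηF confines positive values of v to a finite set of states. At a positive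
    -- space-time maximum, ∂ₜv ≥ 0 and Qv ≤ 0, whereas the subsolution inequality gives ∂ₜv ≤ Qv -
    -- Kv < 0. Then η → 0.
    set v : ℝ → X → ℝ := fun t i => Real.exp (-K * t) * u t i - η * F i with hv
    have hfin := h.proper (max B 0 / η)
    have hout : ∀ t, 0 ≤ t → t ≤ T → ∀ i, i ∉ hfin.toFinset → v t i ≤ 0 := by
      intro t ht htT i hi
      have hi' : max B 0 / η < F i := by simpa using hi
      rw [div_lt_iff₀ hη] at hi'
      have h1 : Real.exp (-K * t) * u t i ≤ max B 0 := by
        calc Real.exp (-K * t) * u t i ≤ Real.exp (-K * t) * max B 0 := by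
              gcongr
              exact (hB t ht htT i).trans (le_max_left _ _)
          _ ≤ 1 * max B 0 := mul_le_mul_of_nonneg_right
              (Real.exp_le_one_iff.2 (by nlinarith)) (le_max_right _ _)
          _ = _ := one_mul _
      simp only [hv]; linarith
    have hpos : 0 < v T i₀ := by simp only [hv]; linarith
    have hmem : i₀ ∈ hfin.toFinset := by
      by_contra hi
      linarith [hout T hT le_rfl i₀ hi]
    have hder : ∀ t, 0 ≤ t → ∀ i, HasDerivWithinAt (fun s => v s i)
        (-K * Real.exp (-K * t) * u t i + Real.exp (-K * t) * d t i) (Set.Ici 0) t := by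
      intro t ht i
      have h1 : HasDerivWithinAt (fun s : ℝ => Real.exp (-K * s))
          (-K * Real.exp (-K * t)) (Set.Ici 0) t := by
        have := (((hasDerivAt_id t).const_mul (-K)).exp).hasDerivWithinAt (s := Set.Ici 0)
        simpa [mul_comm] using this
      exact (h1.mul (hu t ht i)).sub_const _
    have hcont : ∀ i, ContinuousOn (fun s => v s i) (Set.Icc 0 T) := fun i t ht =>
      ((hder t ht.1 i).continuousWithinAt).mono Set.Icc_subset_Ici_self
    choose τ hτ hτmax using fun i => isCompact_Icc.exists_isMaxOn
      (Set.nonempty_Icc.2 hT) (hcont i)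
    obtain ⟨j, hj, hjmax⟩ := hfin.toFinset.exists_max_image (fun i => v (τ i) i) ⟨i₀, hmem⟩
    have hle : ∀ t, 0 ≤ t → t ≤ T → ∀ i, i ∈ hfin.toFinset → v t i ≤ v (τ j) j :=
      fun t ht htT i hi => (hτmax i ⟨ht, htT⟩).trans (hjmax i hi)
    have hjpos : 0 < v (τ j) j := hpos.trans_le (hle T hT le_rfl i₀ hmem)
    have hle' : ∀ t, 0 ≤ t → t ≤ T → ∀ i, v t i ≤ v (τ j) j := by
      intro t ht htT i
      by_cases hi : i ∈ hfin.toFinset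
      · exact hle t ht htT i hi
      · exact (hout t ht htT i hi).trans hjpos.le
    obtain ⟨hτ0, hτT⟩ := hτ j
    have hτpos : 0 < τ j := by
      rcases hτ0.eq_or_lt with h00 | h00
      · exfalso
        rw [← h00] at hjpos
        simp only [hv, mul_zero, Real.exp_zero, one_mul] at hjpos
        nlinarith [h0 j, h.one_le j]
      · exact h00
    have hD := deriv_nonneg_of_left_max hτpos
      ((hder (τ j) hτ0 j).hasDerivAt (Ici_mem_nhds hτpos))
      (fun s hs hst => hle' s hs (hst.trans hτT) j)
    have hQ := h.apply_nonpos_of_max (v (τ j)) j (fun k => hle' (τ j) hτ0 hτT k)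
    have hQ2 : ∑ k ∈ S j, Q j k * v (τ j) k = Real.exp (-K * τ j) *
        ∑ k ∈ S j, Q j k * u (τ j) k - η * ∑ k ∈ S j, Q j k * F k := by
      simp only [hv, Finset.mul_sum, ← Finset.sum_sub_distrib]
      exact Finset.sum_congr rfl fun k _ => by ring
    have h3 : Real.exp (-K * τ j) * d (τ j) j ≤
        Real.exp (-K * τ j) * ∑ k ∈ S j, Q j k * u (τ j) k := by
      gcongr
      exact hd _ hτ0 j
    have h4 : η * ∑ k ∈ S j, Q j k * F k ≤ η * (K * F j) := by
      gcongr
      exact (h.bound j).trans (mul_le_mul_of_nonneg_right hKC (by linarith [h.one_le j]))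
    have h5 : Real.exp (-K * τ j) * u (τ j) j = v (τ j) j + η * F j := by simp only [hv]; ring
    have h6 : 0 < K * v (τ j) j := mul_pos hK0 hjpos
    have h7 : -K * Real.exp (-K * τ j) * u (τ j) j = -K * v (τ j) j - η * (K * F j) := by
      rw [mul_assoc, h5]; ring
    linarith
  have h1 : Real.exp (-K * T) * u T i₀ ≤ 0 := by
    refine le_of_forall_pos_le_add fun ε hε => ?_
    have hF : 0 < F i₀ := by linarith [h.one_le i₀]
    have := key (ε / F i₀) (div_pos hε hF)
    rw [div_mul_cancel₀ _ hF.ne'] at this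
    linarith
  by_contra hcon
  push Not at hcon
  exact absurd h1 (not_le.2 (mul_pos (Real.exp_pos _) hcon))

/-- Uniqueness for the backward equation among solutions bounded on finite time intervals. -/
theorem eq_of_isBackwardSolution (h : HasLyapunov Q S F C) {u v : ℝ → X → ℝ}
    (hu : IsBackwardSolution Q S u) (hv : IsBackwardSolution Q S v) (h0 : ∀ i, u 0 i = v 0 i)
    (hBu : ∀ T, ∃ B, ∀ t, 0 ≤ t → t ≤ T → ∀ i, |u t i| ≤ B)
    (hBv : ∀ T, ∃ B, ∀ t, 0 ≤ t → t ≤ T → ∀ i, |v t i| ≤ B) :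
    ∀ t, 0 ≤ t → ∀ i, u t i = v t i := by
  have aux : ∀ u v : ℝ → X → ℝ, IsBackwardSolution Q S u → IsBackwardSolution Q S v →
      (∀ i, u 0 i = v 0 i) → (∀ T, ∃ B, ∀ t, 0 ≤ t → t ≤ T → ∀ i, |u t i| ≤ B) →
      (∀ T, ∃ B, ∀ t, 0 ≤ t → t ≤ T → ∀ i, |v t i| ≤ B) → ∀ t, 0 ≤ t → ∀ i, u t i ≤ v t i := by
    intro u v hu hv h0 hBu hBv t ht i
    have := h.nonpos_of_subsolution (u := fun t i => u t i - v t i)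
      (fun t ht i => (hu t ht i).sub (hv t ht i))
      (fun t ht i => by simp only [mul_sub, Finset.sum_sub_distrib, le_refl])
      (fun i => by simp [h0 i]) (fun T => by
        obtain ⟨B, hB⟩ := hBu T
        obtain ⟨B', hB'⟩ := hBv T
        refine ⟨B + B', fun t ht htT i => ?_⟩
        have h1 := abs_le.1 (hB t ht htT i)
        have h2 := abs_le.1 (hB' t ht htT i)
        linarith) t ht i
    linarith
  exact fun t ht i => le_antisymm (aux u v hu hv h0 hBu hBv t ht i)
    (aux v u hv hu (fun i => (h0 i).symm) hBv hBu t ht i)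

theorem isRateMatrix [DecidableEq X] (h : HasLyapunov Q S F C) : IsRateMatrix Q := by
  refine ⟨h.nonneg, fun i => ?_⟩
  have h1 : HasSum (fun j => Q i j) 0 := by
    rw [← h.conservative i]
    exact hasSum_sum_of_ne_finset_zero fun j hj => h.support i j hj
  have h2 := (hasSum_ite_sub_hasSum h1 i)
  have h3 : HasSum (fun j => if j = i then 0 else Q i j) (-Q i i) := by simpa using h2
  refine (hasSum_subtype_iff_indicator (f := fun j => Q i j) (s := {j | j ≠ i})).2 ?_
  convert h3 using 1
  ext j
  by_cases hj : j = i <;> simp [hj]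

end HasLyapunov

/-! ### The minimal solution and its integral equation -/

theorem measurable_lintegral_convolution {e g : ℝ → ℝ≥0∞} (he : Measurable e)
    (hg : Measurable g) : Measurable fun t => ∫⁻ s in Set.Icc (0 : ℝ) t, e s * g (t - s) := by
  have h1 : (fun t => ∫⁻ s in Set.Icc (0 : ℝ) t, e s * g (t - s)) = fun t => ∫⁻ s,
      Set.indicator {p : ℝ × ℝ | 0 ≤ p.2 ∧ p.2 ≤ p.1} (fun p => e p.2 * g (p.1 - p.2)) (t, s) := by
    ext t
    rw [← MeasureTheory.lintegral_indicator measurableSet_Icc]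
    rfl
  rw [h1]
  refine Measurable.lintegral_prod_right' (Measurable.indicator ?_ ?_)
  · exact (he.comp measurable_snd).mul (hg.comp (measurable_fst.sub measurable_snd))
  · exact (measurableSet_le measurable_const measurable_snd).inter
      (measurableSet_le measurable_snd measurable_fst)

/-- The probability that an exponential holding time of rate -q has ended by time t. -/
theorem lintegral_exp_mul_neg {q t : ℝ} (hq : q ≤ 0) (ht : 0 ≤ t) :
    ∫⁻ s in Set.Icc (0 : ℝ) t, ENNReal.ofReal (Real.exp (q * s)) * ENNReal.ofReal (-q) =
      ENNReal.ofReal (1 - Real.exp (q * t)) := by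
  have hc : Continuous fun s : ℝ => Real.exp (q * s) * -q := by fun_prop
  have hd : ∀ x ∈ Set.uIcc 0 t,
      HasDerivAt (fun s : ℝ => -Real.exp (q * s)) (Real.exp (q * x) * -q) x := by
    intro x _
    exact (((hasDerivAt_id x).const_mul q).exp.neg).congr_deriv (by simp)
  have hI := intervalIntegral.integral_eq_sub_of_hasDerivAt hd (hc.intervalIntegrable _ _)
  rw [intervalIntegral.integral_of_le ht, ← MeasureTheory.integral_Icc_eq_integral_Ioc] at hI
  simp only [← ENNReal.ofReal_mul (Real.exp_pos _).le]
  rw [← MeasureTheory.ofReal_integral_eq_lintegral_ofReal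
    (hc.continuousOn.integrableOn_compact isCompact_Icc)
    (Filter.Eventually.of_forall fun s => mul_nonneg (Real.exp_pos _).le (by linarith)), hI]
  congr 1
  simp; ring

theorem IsRateMatrix.diag_nonpos {X : Type*} {Q : Matrix X X ℝ} (hQ : IsRateMatrix Q) (i : X) :
    Q i i ≤ 0 := by
  have := (hQ.conservative i).nonneg fun j : {j // j ≠ i} => hQ.nonneg i j (Ne.symm j.2)
  linarith

theorem IsRateMatrix.tsum_ofReal {X : Type*} {Q : Matrix X X ℝ} (hQ : IsRateMatrix Q) (i : X) :
    ∑' k : {k : X // k ≠ i}, ENNReal.ofReal (Q i k) = ENNReal.ofReal (-Q i i) := by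
  rw [← (hQ.conservative i).tsum_eq, ENNReal.ofReal_tsum_of_nonneg
    (fun j : {j // j ≠ i} => hQ.nonneg i j (Ne.symm j.2)) (hQ.conservative i).summable]

variable {X : Type*} [DecidableEq X]

/-- `∑_j P^{[n]}(t; i, j) f(j)`. -/
noncomputable def jumpApply (Q : Matrix X X ℝ) (f : X → ℝ≥0∞) (n : ℕ) (t : ℝ) (i : X) : ℝ≥0∞ :=
  ∑' j, jumpProb Q n t i j * f j

/-- The action of the minimal solution on a function. -/
noncomputable def minimalApply (Q : Matrix X X ℝ) (f : X → ℝ≥0∞) (t : ℝ) (i : X) : ℝ≥0∞ :=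
  ∑' j, minimalSolution Q t i j * f j

theorem jumpApply_zero (Q : Matrix X X ℝ) (f : X → ℝ≥0∞) (t : ℝ) (i : X) :
    jumpApply Q f 0 t i = ENNReal.ofReal (Real.exp (Q i i * t)) * f i := by
  rw [jumpApply, tsum_eq_single i]
  · simp [jumpProb]
  · intro j hj
    simp [jumpProb, Ne.symm hj]

theorem minimalApply_eq_tsum (Q : Matrix X X ℝ) (f : X → ℝ≥0∞) (t : ℝ) (i : X) :
    minimalApply Q f t i = ∑' n, jumpApply Q f n t i := by
  simp only [minimalApply, minimalSolution, jumpApply, ← ENNReal.tsum_mul_right]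
  exact ENNReal.tsum_comm

variable [Countable X]

theorem measurable_jumpProb (Q : Matrix X X ℝ) (n : ℕ) :
    ∀ i j, Measurable fun t => jumpProb Q n t i j := by
  induction n with
  | zero =>
    intro i j
    simp only [jumpProb]
    split_ifs
    · fun_prop
    · fun_prop
  | succ n ih =>
    intro i j
    simp only [jumpProb]
    exact measurable_lintegral_convolution
      (e := fun s => ENNReal.ofReal (Real.exp (Q i i * s)))
      (g := fun r => ∑' k : {k : X // k ≠ i}, ENNReal.ofReal (Q i k) * jumpProb Q n r k j)
      (by fun_prop) (Measurable.tsum fun k => (ih k j).const_mul _)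

theorem measurable_jumpApply (Q : Matrix X X ℝ) (f : X → ℝ≥0∞) (n : ℕ) (i : X) :
    Measurable fun t => jumpApply Q f n t i :=
  Measurable.tsum fun j => (measurable_jumpProb Q n i j).mul_const _

theorem measurable_minimalApply (Q : Matrix X X ℝ) (f : X → ℝ≥0∞) (i : X) :
    Measurable fun t => minimalApply Q f t i :=
  Measurable.tsum fun j =>
    (Measurable.tsum fun n => measurable_jumpProb Q n i j).mul_const _

theorem jumpApply_succ (Q : Matrix X X ℝ) (f : X → ℝ≥0∞) (n : ℕ) (t : ℝ) (i : X) :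
    jumpApply Q f (n + 1) t i = ∫⁻ s in Set.Icc (0 : ℝ) t, ENNReal.ofReal (Real.exp (Q i i * s)) *
      ∑' k : {k : X // k ≠ i}, ENNReal.ofReal (Q i k) * jumpApply Q f n (t - s) k := by
  have hm : ∀ j, Measurable fun s => ENNReal.ofReal (Real.exp (Q i i * s)) *
        ∑' k : {k : X // k ≠ i}, ENNReal.ofReal (Q i k) * jumpProb Q n (t - s) k j := fun j =>
    Measurable.mul (by fun_prop) (Measurable.tsum fun k =>
      ((measurable_jumpProb Q n k j).comp (measurable_const.sub measurable_id)).const_mul _)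
  simp only [jumpApply, jumpProb]
  simp_rw [← MeasureTheory.lintegral_mul_const _ (hm _)]
  rw [← MeasureTheory.lintegral_tsum fun j => ((hm j).mul_const _).aemeasurable]
  refine MeasureTheory.lintegral_congr fun s => ?_
  simp only [mul_assoc]
  rw [ENNReal.tsum_mul_left]
  congr 1
  simp only [← ENNReal.tsum_mul_left, ← ENNReal.tsum_mul_right]
  rw [ENNReal.tsum_comm]
  simp only [mul_assoc]

/-- Decomposition at the first jump: the recursion summed over the number of jumps, with Tonelli for
the interchanges. -/
theorem minimalApply_eq (Q : Matrix X X ℝ) (f : X → ℝ≥0∞) (t : ℝ) (i : X) :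
    minimalApply Q f t i = ENNReal.ofReal (Real.exp (Q i i * t)) * f i +
      ∫⁻ s in Set.Icc (0 : ℝ) t, ENNReal.ofReal (Real.exp (Q i i * s)) *
        ∑' k : {k : X // k ≠ i}, ENNReal.ofReal (Q i k) * minimalApply Q f (t - s) k := by
  have hm : ∀ n, Measurable fun s => ENNReal.ofReal (Real.exp (Q i i * s)) *
        ∑' k : {k : X // k ≠ i}, ENNReal.ofReal (Q i k) * jumpApply Q f n (t - s) k := fun n =>
    Measurable.mul (by fun_prop) (Measurable.tsum fun k =>
      ((measurable_jumpApply Q f n k).comp (measurable_const.sub measurable_id)).const_mul _)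
  rw [minimalApply_eq_tsum, tsum_eq_zero_add' ENNReal.summable, jumpApply_zero]
  congr 1
  simp only [jumpApply_succ]
  rw [← MeasureTheory.lintegral_tsum fun n => (hm n).aemeasurable]
  refine MeasureTheory.lintegral_congr fun s => ?_
  rw [ENNReal.tsum_mul_left]
  congr 1
  simp only [minimalApply_eq_tsum, ← ENNReal.tsum_mul_left]
  rw [ENNReal.tsum_comm]

/-- Induction on the number of jumps: no jump contributes at most e^{Q i i t}, and a first jump
before t at most 1 - e^{Q i i t}, because what follows it has mass at most 1. -/
theorem sum_jumpApply_le_one {Q : Matrix X X ℝ} (hQ : IsRateMatrix Q) {f : X → ℝ≥0∞}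
    (hf : ∀ j, f j ≤ 1) (M : ℕ) :
    ∀ t, 0 ≤ t → ∀ i, ∑ n ∈ Finset.range M, jumpApply Q f n t i ≤ 1 := by
  induction M with
  | zero => intro t _ i; simp
  | succ M ih =>
    intro t ht i
    have hm : ∀ n, Measurable fun s => ENNReal.ofReal (Real.exp (Q i i * s)) *
        ∑' k : {k : X // k ≠ i}, ENNReal.ofReal (Q i k) * jumpApply Q f n (t - s) k := fun n =>
      Measurable.mul (by fun_prop) (Measurable.tsum fun k =>
        ((measurable_jumpApply Q f n k).comp (measurable_const.sub measurable_id)).const_mul _)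
    rw [Finset.sum_range_succ', jumpApply_zero]
    simp only [jumpApply_succ]
    rw [← MeasureTheory.lintegral_finsetSum _ fun n _ => hm n]
    have h1 : ∫⁻ s in Set.Icc (0 : ℝ) t, ∑ n ∈ Finset.range M,
        ENNReal.ofReal (Real.exp (Q i i * s)) *
        ∑' k : {k : X // k ≠ i}, ENNReal.ofReal (Q i k) * jumpApply Q f n (t - s) k ≤
        ∫⁻ s in Set.Icc (0 : ℝ) t, ENNReal.ofReal (Real.exp (Q i i * s)) *
          ENNReal.ofReal (-Q i i) := by
      refine MeasureTheory.setLIntegral_mono' measurableSet_Icc fun s hs => ?_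
      rw [← Finset.mul_sum, ← Summable.tsum_finsetSum (fun _ _ => ENNReal.summable)]
      gcongr
      rw [← hQ.tsum_ofReal i]
      refine ENNReal.tsum_le_tsum fun k => ?_
      rw [← Finset.mul_sum]
      exact mul_le_of_le_one_right' (ih (t - s) (by linarith [hs.2]) k)
    rw [lintegral_exp_mul_neg (hQ.diag_nonpos i) ht] at h1
    calc _ ≤ ENNReal.ofReal (1 - Real.exp (Q i i * t)) +
          ENNReal.ofReal (Real.exp (Q i i * t)) * 1 := by gcongr; exact hf i
      _ = 1 := by
        rw [mul_one, ← ENNReal.ofReal_add _ (Real.exp_pos _).le]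
        · simp
        · rw [sub_nonneg, Real.exp_le_one_iff]
          exact mul_nonpos_of_nonpos_of_nonneg (hQ.diag_nonpos i) ht

theorem minimalApply_le_one {Q : Matrix X X ℝ} (hQ : IsRateMatrix Q) {f : X → ℝ≥0∞}
    (hf : ∀ j, f j ≤ 1) {t : ℝ} (ht : 0 ≤ t) (i : X) : minimalApply Q f t i ≤ 1 := by
  rw [minimalApply_eq_tsum]
  exact ENNReal.tsum_le_of_sum_range_le fun M => sum_jumpApply_le_one hQ hf M t ht i

/-- A function given by a variation of constants formula solves the linear equation. -/
theorem hasDerivAt_variation_of_constants {h : ℝ → ℝ} (hh : Continuous h) (q c t : ℝ) :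
    HasDerivAt (fun t => Real.exp (q * t) * (c + ∫ r in (0 : ℝ)..t, Real.exp (-q * r) * h r))
      (q * (Real.exp (q * t) * (c + ∫ r in (0 : ℝ)..t, Real.exp (-q * r) * h r)) + h t) t := by
  have hc : Continuous fun r => Real.exp (-q * r) * h r := by fun_prop
  have h1 : HasDerivAt (fun t => ∫ r in (0 : ℝ)..t, Real.exp (-q * r) * h r)
      (Real.exp (-q * t) * h t) t := (hc.integral_hasStrictDerivAt 0 t).hasDerivAt
  have h2 : HasDerivAt (fun t : ℝ => Real.exp (q * t)) (q * Real.exp (q * t)) t := by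
    simpa [mul_comm] using ((hasDerivAt_id t).const_mul q).exp
  refine (h2.mul (h1.const_add c)).congr_deriv ?_
  have h3 : Real.exp (q * t) * Real.exp (-q * t) = 1 := by
    rw [← Real.exp_add]; simp
  linear_combination (h t) * h3

/-- The action of the minimal solution on `[0, 1]`-valued functions solves the backward
equation. -/
theorem HasLyapunov.isBackwardSolution_minimalApply {Q : Matrix X X ℝ} {S : X → Finset X}
    {F : X → ℝ} {C : ℝ} (h : HasLyapunov Q S F C) {f : X → ℝ≥0∞} (hf : ∀ j, f j ≤ 1) :
    IsBackwardSolution Q S (fun t i => (minimalApply Q f t i).toReal) := by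
  have hQ := h.isRateMatrix
  -- Time is clamped at 0 because the bound by 1 fails for negative times; w is bounded and
  -- measurable on the whole line.
  set w : ℝ → X → ℝ := fun t i => (minimalApply Q f (max t 0) i).toReal with hw
  have hw0 : ∀ t i, 0 ≤ w t i := fun t i => ENNReal.toReal_nonneg
  have hw1 : ∀ t i, w t i ≤ 1 := fun t i =>
    ENNReal.toReal_le_of_le_ofReal zero_le_one
      (by simpa using minimalApply_le_one hQ hf (le_max_right t 0) i)
  have hwm : ∀ i, Measurable fun t => w t i := fun i =>
    ((measurable_minimalApply Q f i).comp (measurable_id.max measurable_const)).ennreal_toReal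
  set g : X → ℝ → ℝ := fun i t => ∑ k ∈ (S i).erase i, Q i k * w t k with hg
  have hgm : ∀ i, Measurable (g i) := fun i =>
    Finset.measurable_sum _ fun k _ => (hwm k).const_mul _
  have hg0 : ∀ i t, 0 ≤ g i t := fun i t => Finset.sum_nonneg fun k hk =>
    mul_nonneg (h.nonneg i k (Finset.ne_of_mem_erase hk).symm) (hw0 t k)
  have hg1 : ∀ i t, g i t ≤ ∑ k ∈ (S i).erase i, Q i k := fun i t =>
    Finset.sum_le_sum fun k hk =>
      mul_le_of_le_one_right (h.nonneg i k (Finset.ne_of_mem_erase hk).symm) (hw1 t k)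
  have hint : ∀ i (a b : ℝ), IntervalIntegrable (fun r => Real.exp (-Q i i * r) * g i r)
      MeasureTheory.volume a b := by
    intro i a b
    refine IntervalIntegrable.continuousOn_mul ?_ (by fun_prop)
    refine (intervalIntegrable_const (c := ∑ k ∈ (S i).erase i, Q i k)).mono_fun
      (hgm i).aestronglyMeasurable (Filter.Eventually.of_forall fun t => ?_)
    refine (Real.norm_of_nonneg (hg0 i t)).le.trans ?_
    exact (hg1 i t).trans (le_abs_self _)
  -- The substitution r = t - s turns the first-jump equation into a variation of constants formula.
  have hrep : ∀ i t, 0 ≤ t → w t i = Real.exp (Q i i * t) *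
      ((f i).toReal + ∫ r in (0 : ℝ)..t, Real.exp (-Q i i * r) * g i r) := by
    intro i t ht
    have hsum : ∀ s ∈ Set.Icc (0 : ℝ) t, ENNReal.ofReal (Real.exp (Q i i * s)) *
        ∑' k : {k : X // k ≠ i}, ENNReal.ofReal (Q i k) * minimalApply Q f (t - s) k =
        ENNReal.ofReal (Real.exp (Q i i * s) * g i (t - s)) := by
      intro s hs
      rw [ENNReal.ofReal_mul (Real.exp_pos _).le]
      congr 1
      have hts : max (t - s) 0 = t - s := max_eq_left (by linarith [hs.2])
      have e1 : ∀ k, ENNReal.ofReal (w (t - s) k) = minimalApply Q f (t - s) k := by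
        intro k
        simp only [hw, hts]
        exact ENNReal.ofReal_toReal (ne_top_of_le_ne_top ENNReal.one_ne_top
          (minimalApply_le_one hQ hf (by linarith [hs.2]) k))
      rw [hg, ENNReal.ofReal_sum_of_nonneg fun k hk =>
        mul_nonneg (h.nonneg i k (Finset.ne_of_mem_erase hk).symm) (hw0 _ k)]
      refine (tsum_subtype {k | k ≠ i}
        (fun k => ENNReal.ofReal (Q i k) * minimalApply Q f (t - s) k)).trans ?_
      rw [tsum_eq_sum (s := (S i).erase i)]
      · refine Finset.sum_congr rfl fun k hk => ?_
        have hki := Finset.ne_of_mem_erase hk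
        rw [Set.indicator_of_mem (by exact hki), ← e1,
          ENNReal.ofReal_mul (h.nonneg i k hki.symm)]
      · intro k hk
        by_cases hki : k = i
        · exact Set.indicator_of_notMem (by simpa using hki) _
        · have : k ∉ S i := fun h' => hk (Finset.mem_erase.2 ⟨hki, h'⟩)
          rw [Set.indicator_of_mem (by exact hki), h.support i k this]
          simp
    have hI0 : ∀ s, 0 ≤ Real.exp (Q i i * s) * g i (t - s) := fun s =>
      mul_nonneg (Real.exp_pos _).le (hg0 _ _)
    have hIm : Measurable fun s => Real.exp (Q i i * s) * g i (t - s) :=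
      Measurable.mul (by fun_prop) ((hgm i).comp (measurable_const.sub measurable_id))
    have hle := minimalApply_le_one hQ hf ht i
    have heq := minimalApply_eq Q f t i
    rw [MeasureTheory.setLIntegral_congr_fun measurableSet_Icc hsum] at heq
    have hfin : ∫⁻ s in Set.Icc (0 : ℝ) t, ENNReal.ofReal (Real.exp (Q i i * s) * g i (t - s)) ≠ ∞ :=
      ne_top_of_le_ne_top ENNReal.one_ne_top ((le_add_self.trans_eq heq.symm).trans hle)
    have hreal : w t i = Real.exp (Q i i * t) * (f i).toReal +
        ∫ s in (0 : ℝ)..t, Real.exp (Q i i * s) * g i (t - s) := by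
      rw [intervalIntegral.integral_of_le ht, ← MeasureTheory.integral_Icc_eq_integral_Ioc,
        MeasureTheory.integral_eq_lintegral_of_nonneg_ae
          (Filter.Eventually.of_forall hI0) hIm.aestronglyMeasurable]
      simp only [hw, max_eq_left ht]
      rw [heq, ENNReal.toReal_add _ hfin, ENNReal.toReal_mul,
        ENNReal.toReal_ofReal (Real.exp_pos _).le]
      exact ENNReal.mul_ne_top ENNReal.ofReal_ne_top
        (ne_top_of_le_ne_top ENNReal.one_ne_top (hf i))
    have hsub := intervalIntegral.integral_comp_sub_left (a := 0) (b := t)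
      (fun r => Real.exp (Q i i * (t - r)) * g i r) t
    simp only [sub_sub_cancel, sub_zero, sub_self] at hsub
    rw [hreal, hsub, mul_add, ← intervalIntegral.integral_const_mul]
    congr 1
    refine intervalIntegral.integral_congr fun r _ => ?_
    rw [← mul_assoc, ← Real.exp_add]
    congr 2
    ring
  -- Bootstrap: with merely bounded measurable g, the formula makes w continuous, hence g
  -- continuous, hence w differentiable.
  have hwc : ∀ i, Continuous fun t => w t i := by
    intro i
    have h1 : (fun t => w t i) = fun t => Real.exp (Q i i * max t 0) *
      ((f i).toReal + ∫ r in (0 : ℝ)..(max t 0), Real.exp (-Q i i * r) * g i r) := by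
      ext t
      rw [← hrep i _ (le_max_right t 0)]
      simp [hw]
    rw [h1]
    have h2 := intervalIntegral.continuous_primitive (hint i) 0
    have h3 : Continuous fun t : ℝ => max t 0 := by fun_prop
    exact Continuous.mul (by fun_prop) (continuous_const.add (h2.comp h3))
  have hgc : ∀ i, Continuous (g i) := fun i =>
    continuous_finsetSum _ fun k _ => (hwc k).const_smul (Q i k)
  intro t ht i
  have hww : ∀ s, 0 ≤ s → ∀ k, (minimalApply Q f s k).toReal = w s k := by
    intro s hs k; simp only [hw, max_eq_left hs]
  have hD := (hasDerivAt_variation_of_constants (hgc i) (Q i i) (f i).toReal t).hasDerivWithinAt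
    (s := Set.Ici 0)
  rw [← hrep i t ht] at hD
  have hval : Q i i * w t i + g i t =
      ∑ k ∈ S i, Q i k * (minimalApply Q f t k).toReal := by
    simp only [hww t ht, hg]
    by_cases hi : i ∈ S i
    · rw [Finset.add_sum_erase _ (fun k => Q i k * w t k) hi]
    · rw [h.support i i hi, Finset.erase_eq_of_notMem hi]; ring
  rw [hval] at hD
  exact hD.congr (fun s hs => (hww s hs i).trans (hrep i s hs)) ((hww t ht i).trans (hrep i t ht))

theorem minimalApply_zero {Q : Matrix X X ℝ} (f : X → ℝ≥0∞) (i : X) :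
    minimalApply Q f 0 i = f i := by
  rw [minimalApply_eq]
  simp

theorem IsBackwardSolution.shift {X : Type*} {Q : Matrix X X ℝ} {S : X → Finset X}
    {u : ℝ → X → ℝ} (hu : IsBackwardSolution Q S u) {s : ℝ} (hs : 0 ≤ s) :
    IsBackwardSolution Q S (fun t => u (t + s)) := by
  intro t ht i
  have h1 := (hu (t + s) (add_nonneg ht hs) i).comp t
    ((hasDerivWithinAt_id t (Set.Ici 0)).add_const s) (fun x hx => add_nonneg hx hs)
  exact h1.congr_deriv (mul_one _)

theorem hasSum_toReal_of_tsum {ι : Type*} {f : ι → ℝ≥0∞} {c : ℝ≥0∞} (h : ∑' x, f x = c)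
    (hc : c ≠ ∞) : HasSum (fun x => (f x).toReal) c.toReal := by
  have hf : ∑' x, f x ≠ ∞ := h ▸ hc
  rw [← h, ENNReal.tsum_toReal_eq fun x => ENNReal.ne_top_of_tsum_ne_top hf x]
  exact ENNReal.hasSum_toReal hf

theorem tendsto_coe_nhdsGT_zero :
    Filter.Tendsto (fun t : ℝ≥0 => (t : ℝ)) (𝓝[>] 0) (𝓝[>] 0) :=
  tendsto_nhdsWithin_iff.2 ⟨(NNReal.continuous_coe.tendsto' 0 0 rfl).mono_left nhdsWithin_le_nhds,
    by filter_upwards [self_mem_nhdsWithin] with t ht using NNReal.coe_pos.2 ht⟩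

theorem tendsto_toNNReal_nhdsGT_zero :
    Filter.Tendsto Real.toNNReal (𝓝[>] 0) (𝓝[>] 0) :=
  tendsto_nhdsWithin_iff.2 ⟨(continuous_real_toNNReal.tendsto' 0 0 (by simp)).mono_left
    nhdsWithin_le_nhds,
    by filter_upwards [self_mem_nhdsWithin] with t ht using Real.toNNReal_pos.2 ht⟩

/-! ### The backward equation for arbitrary semigroups -/

section MarkovSemigroup

variable {X : Type*} [DecidableEq X] {P : ℝ≥0 → Matrix X X ℝ}

namespace IsMarkovSemigroup

theorem le_one (hP : IsMarkovSemigroup P) (t : ℝ≥0) (i j : X) : P t i j ≤ 1 :=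
  le_hasSum (hP.rowSum t i) j fun k _ => hP.nonneg t i k

theorem abs_le_one (hP : IsMarkovSemigroup P) (t : ℝ≥0) (i j : X) : |P t i j| ≤ 1 := by
  rw [abs_of_nonneg (hP.nonneg t i j)]; exact hP.le_one t i j

/-- Entries of P t lie in [0, 1], so restricting the Chapman–Kolmogorov sum to A loses at most the
mass of row i outside A. -/
theorem abs_sub_sum_le (hP : IsMarkovSemigroup P) (A : Finset X) (s t : ℝ≥0) (i j : X) :
    |P (s + t) i j - ∑ k ∈ A, P s i k * P t k j| ≤ 1 - ∑ k ∈ A, P s i k := by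
  have h1 := hP.chapmanKolmogorov s t i j
  have h2 := sum_le_hasSum A (fun k _ => mul_nonneg (hP.nonneg s i k) (hP.nonneg t k j)) h1
  have h3 := sum_le_hasSum A (fun k _ => by
    have := mul_le_of_le_one_right (hP.nonneg s i k) (hP.le_one t k j)
    linarith) ((hP.rowSum s i).sub h1)
  rw [Finset.sum_sub_distrib] at h3
  rw [abs_of_nonneg (by linarith)]
  linarith

/-- The modulus does not depend on t, so continuity at time 0 propagates to all times. -/
theorem abs_sub_le (hP : IsMarkovSemigroup P) (s t : ℝ≥0) (i j : X) :
    |P (s + t) i j - P t i j| ≤ 2 * (1 - P s i i) := by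
  have h1 := hP.abs_sub_sum_le {i} s t i j
  simp only [Finset.sum_singleton] at h1
  have h2 : |P s i i * P t i j - P t i j| ≤ 1 - P s i i := by
    have h3 : P s i i * P t i j - P t i j = -((1 - P s i i) * P t i j) := by ring
    rw [h3, abs_neg, abs_of_nonneg (mul_nonneg (by linarith [hP.le_one s i i]) (hP.nonneg _ _ _))]
    exact mul_le_of_le_one_right (by linarith [hP.le_one s i i]) (hP.le_one _ _ _)
  calc _ = |(P (s + t) i j - P s i i * P t i j) + (P s i i * P t i j - P t i j)| := by ring_nf
    _ ≤ _ := abs_add_le _ _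
    _ ≤ _ := by linarith

theorem continuous_entry (hP : IsMarkovSemigroup P) (i j : X) :
    Continuous fun t => P t i j := by
  rw [Metric.continuous_iff]
  intro t ε hε
  have h1 := hP.standard i i
  have h2 : ∀ᶠ s : ℝ≥0 in 𝓝[>] 0, 2 * (1 - P s i i) < ε := by
    have h3 : Filter.Tendsto (fun s : ℝ≥0 => 2 * (1 - P s i i)) (𝓝[>] 0) (𝓝 0) := by
      simpa using (h1.const_sub 1).const_mul 2
    exact h3.eventually_lt_const hε
  obtain ⟨δ, hδ, hδs⟩ := mem_nhdsGT_iff_exists_Ioo_subset.1 h2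
  have key : ∀ a b : ℝ≥0, a < b → dist b a < δ → |P b i j - P a i j| < ε := by
    intro a b hab hd
    have hba : b = (b - a) + a := (tsub_add_cancel_of_le hab.le).symm
    rw [hba]
    refine (hP.abs_sub_le (b - a) a i j).trans_lt (hδs ⟨tsub_pos_of_lt hab, ?_⟩)
    rw [NNReal.dist_eq, abs_of_pos (sub_pos.2 (NNReal.coe_lt_coe.2 hab)),
      ← NNReal.coe_sub hab.le] at hd
    exact_mod_cast hd
  refine ⟨δ, NNReal.coe_pos.2 hδ, fun a ha => ?_⟩
  rw [Real.dist_eq]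
  rcases lt_trichotomy a t with hat | rfl | hat
  · rw [abs_sub_comm]
    exact key a t hat (by rwa [dist_comm])
  · simpa using hε
  · exact key t a hat ha

/-- The backward equation for an arbitrary semigroup whose `q`-matrix is conservative with finite
rows. -/
theorem isBackwardSolution (hP : IsMarkovSemigroup P) {Q : Matrix X X ℝ} (hPQ : HasQMatrix P Q)
    {S : X → Finset X} {F : X → ℝ} {C : ℝ} (h : HasLyapunov Q S F C) (j : X) :
    IsBackwardSolution Q S (fun t i => P t.toNNReal i j) := by
  have hc : ∀ i, Continuous fun t : ℝ => P t.toNNReal i j := fun i =>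
    (hP.continuous_entry i j).comp continuous_real_toNNReal
  have hr : ∀ t, 0 ≤ t → ∀ i, HasDerivWithinAt (fun t : ℝ => P t.toNNReal i j)
      (∑ k ∈ S i, Q i k * P t.toNNReal k j) (Set.Ioi t) t := by
    intro t ht i
    rw [hasDerivWithinAt_iff_tendsto_slope' (by simp)]
    -- Including i lets the identity matrix be summed over A exactly.
    set A := insert i (S i) with hA
    have hSA : S i ⊆ A := Finset.subset_insert _ _
    have hsub : Filter.Tendsto (fun y : ℝ => y - t) (𝓝[>] t) (𝓝[>] 0) := by
      refine tendsto_nhdsWithin_iff.2 ⟨?_, ?_⟩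
      · exact (Continuous.tendsto' (by fun_prop) t 0 (by simp)).mono_left nhdsWithin_le_nhds
      · filter_upwards [self_mem_nhdsWithin] with y hy using Set.mem_Ioi.2 (sub_pos.2 (Set.mem_Ioi.1 hy))
    have hq : ∀ k, Filter.Tendsto (fun y : ℝ =>
        (P (y - t).toNNReal i k - (1 : Matrix X X ℝ) i k) / (y - t)) (𝓝[>] t) (𝓝 (Q i k)) := by
      intro k
      refine ((hPQ i k).comp (tendsto_toNNReal_nhdsGT_zero.comp hsub)).congr' ?_
      filter_upwards [self_mem_nhdsWithin] with y hy
      simp [Real.coe_toNNReal _ (sub_pos.2 hy).le]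
    have hmain : Filter.Tendsto (fun y : ℝ => ∑ k ∈ A,
        (P (y - t).toNNReal i k - (1 : Matrix X X ℝ) i k) / (y - t) * P t.toNNReal k j)
        (𝓝[>] t) (𝓝 (∑ k ∈ S i, Q i k * P t.toNNReal k j)) := by
      rw [Finset.sum_subset hSA fun k _ hk => by rw [h.support i k hk, zero_mul]]
      exact tendsto_finsetSum _ fun k _ => (hq k).mul_const _
    -- The truncation error per unit time is bounded by the mass lost from A per unit time, whose
    -- limit -∑_A Q i k vanishes because Q is conservative with support in A.
    have herr : Filter.Tendsto (fun y : ℝ => -∑ k ∈ A,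
        (P (y - t).toNNReal i k - (1 : Matrix X X ℝ) i k) / (y - t)) (𝓝[>] t) (𝓝 0) := by
      have h0 : -∑ k ∈ A, Q i k = 0 := by
        rw [← Finset.sum_subset hSA fun k _ hk => h.support i k hk, h.conservative, neg_zero]
      rw [← h0]
      exact (tendsto_finsetSum _ fun k _ => hq k).neg
    have hdiff : Filter.Tendsto (fun y : ℝ => slope (fun t : ℝ => P t.toNNReal i j) t y -
        ∑ k ∈ A, (P (y - t).toNNReal i k - (1 : Matrix X X ℝ) i k) / (y - t) * P t.toNNReal k j)
        (𝓝[>] t) (𝓝 0) := by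
      refine squeeze_zero_norm' ?_ herr
      filter_upwards [self_mem_nhdsWithin] with y hy
      have hyt : 0 < y - t := sub_pos.2 hy
      have h1 := hP.abs_sub_sum_le A (y - t).toNNReal t.toNNReal i j
      rw [← Real.toNNReal_add hyt.le ht, sub_add_cancel] at h1
      have hone : ∀ f : X → ℝ, ∑ k ∈ A, (1 : Matrix X X ℝ) i k * f k = f i := by
        intro f
        simp [Matrix.one_apply, hA]
      have e1 : slope (fun t : ℝ => P t.toNNReal i j) t y -
          ∑ k ∈ A, (P (y - t).toNNReal i k - (1 : Matrix X X ℝ) i k) / (y - t) * P t.toNNReal k j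
          = (P y.toNNReal i j - ∑ k ∈ A, P (y - t).toNNReal i k * P t.toNNReal k j) / (y - t) := by
        have h3 := hone fun k => P t.toNNReal k j
        simp only [div_mul_eq_mul_div, sub_mul, ← Finset.sum_div, Finset.sum_sub_distrib, h3,
          slope_def_field]
        ring
      have e2 : -∑ k ∈ A, (P (y - t).toNNReal i k - (1 : Matrix X X ℝ) i k) / (y - t) =
          (1 - ∑ k ∈ A, P (y - t).toNNReal i k) / (y - t) := by
        have h3 := hone fun _ => 1
        simp only [mul_one] at h3
        rw [← Finset.sum_div, Finset.sum_sub_distrib, h3]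
        ring
      rw [e1, e2, norm_div, Real.norm_eq_abs, Real.norm_of_nonneg hyt.le]
      gcongr
    simpa using hdiff.add hmain
  intro t ht i
  have hgc : Continuous fun t : ℝ => ∑ k ∈ S i, Q i k * P t.toNNReal k j :=
    continuous_finsetSum _ fun k _ => (hc k).const_smul (Q i k)
  -- So far only right derivatives are known. They are continuous in t, so integrating them and
  -- differentiating the integral gives the derivative within [0, ∞).
  have hrep : ∀ s, 0 ≤ s → P s.toNNReal i j = P (0 : ℝ).toNNReal i j +
      ∫ r in (0 : ℝ)..s, ∑ k ∈ S i, Q i k * P r.toNNReal k j := by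
    intro s hs
    rw [intervalIntegral.integral_eq_sub_of_hasDeriv_right (hc i).continuousOn
      (fun x hx => hr x ((le_min le_rfl hs).trans hx.1.le) i) (hgc.intervalIntegrable _ _)]
    ring
  have hD := ((hgc.integral_hasStrictDerivAt 0 t).hasDerivAt.const_add
    (P (0 : ℝ).toNNReal i j)).hasDerivWithinAt (s := Set.Ici 0)
  exact hD.congr (fun s hs => hrep s hs) (hrep t ht)

end IsMarkovSemigroup

end MarkovSemigroup

/-! ### Non-explosion and uniqueness of the semigroup -/

section Minimal

variable {X : Type*} [DecidableEq X]

/-- The minimal solution as a family of real matrices. -/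
noncomputable def minimalSemigroup (Q : Matrix X X ℝ) (t : ℝ≥0) : Matrix X X ℝ :=
  fun i j => (minimalSolution Q t i j).toReal

theorem minimalApply_single (Q : Matrix X X ℝ) (t : ℝ) (i j : X) :
    minimalApply Q (Pi.single j 1) t i = minimalSolution Q t i j := by
  rw [minimalApply, tsum_eq_single j]
  · simp
  · intro k hk
    simp [hk]

theorem single_le_one (j k : X) : (Pi.single j 1 : X → ℝ≥0∞) k ≤ 1 := by
  by_cases hk : k = j
  · subst hk; simp
  · simp [hk]

namespace HasLyapunov

variable [Countable X] {Q : Matrix X X ℝ} {S : X → Finset X} {F : X → ℝ} {C : ℝ}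

theorem abs_minimalApply_toReal_le (h : HasLyapunov Q S F C) {f : X → ℝ≥0∞} (hf : ∀ j, f j ≤ 1)
    {t : ℝ} (ht : 0 ≤ t) (i : X) : |(minimalApply Q f t i).toReal| ≤ 1 := by
  rw [abs_of_nonneg ENNReal.toReal_nonneg]
  exact ENNReal.toReal_le_of_le_ofReal zero_le_one
    (by simpa using minimalApply_le_one h.isRateMatrix hf ht i)

theorem minimalSolution_le_one (h : HasLyapunov Q S F C) {t : ℝ} (ht : 0 ≤ t) (i j : X) :
    minimalSolution Q t i j ≤ 1 := by
  rw [← minimalApply_single]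
  exact minimalApply_le_one h.isRateMatrix (single_le_one j) ht i

theorem isBackwardSolution_minimalSolution (h : HasLyapunov Q S F C) (j : X) :
    IsBackwardSolution Q S (fun t i => (minimalSolution Q t i j).toReal) := by
  simpa only [minimalApply_single] using h.isBackwardSolution_minimalApply (single_le_one j)

/-- The minimal solution applied to 1 and the constant 1 (Q is conservative) are bounded backward
solutions with the same initial value. -/
theorem tsum_minimalSolution (h : HasLyapunov Q S F C) {t : ℝ} (ht : 0 ≤ t) (i : X) :
    ∑' j, minimalSolution Q t i j = 1 := by
  have hf : ∀ j : X, (fun _ => 1 : X → ℝ≥0∞) j ≤ 1 := fun _ => le_rfl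
  have h1 := h.eq_of_isBackwardSolution (h.isBackwardSolution_minimalApply hf)
    (v := fun _ _ => 1)
    (fun t _ i => by simpa [h.conservative] using hasDerivWithinAt_const t (Set.Ici 0) (1 : ℝ))
    (fun i => by simp [minimalApply_zero])
    (fun T => ⟨1, fun t ht _ i => h.abs_minimalApply_toReal_le hf ht i⟩)
    (fun T => ⟨1, fun t ht _ i => by simp⟩) t ht i
  have h2 : minimalApply Q (fun _ => 1) t i = 1 := by
    rwa [ENNReal.toReal_eq_one_iff] at h1
  simpa [minimalApply] using h2

theorem isNonExplosive (h : HasLyapunov Q S F C) : IsNonExplosive Q :=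
  ⟨h.isRateMatrix, fun _ ht i => h.tsum_minimalSolution ht i⟩

/-- As functions of s, both sides are bounded backward solutions starting from column j at time t.
-/
theorem minimalSolution_add (h : HasLyapunov Q S F C) {s t : ℝ} (hs : 0 ≤ s) (ht : 0 ≤ t)
    (i j : X) : minimalApply Q (fun k => minimalSolution Q t k j) s i =
      minimalSolution Q (s + t) i j := by
  have hf : ∀ k, minimalSolution Q t k j ≤ 1 := fun k => h.minimalSolution_le_one ht k j
  have h1 := h.eq_of_isBackwardSolution (h.isBackwardSolution_minimalApply hf)
    ((h.isBackwardSolution_minimalSolution j).shift ht)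
    (fun i => by simp [minimalApply_zero])
    (fun T => ⟨1, fun t ht _ i => h.abs_minimalApply_toReal_le hf ht i⟩)
    (fun T => ⟨1, fun r hr _ i => by
      simpa only [minimalApply_single] using
        h.abs_minimalApply_toReal_le (single_le_one j) (add_nonneg hr ht) i⟩) s hs i
  exact (ENNReal.toReal_eq_toReal_iff'
    (ne_top_of_le_ne_top ENNReal.one_ne_top (minimalApply_le_one h.isRateMatrix hf hs i))
    (ne_top_of_le_ne_top ENNReal.one_ne_top
      (h.minimalSolution_le_one (add_nonneg hs ht) i j))).1 h1

theorem minimalSolution_zero_toReal (i j : X) :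
    (minimalSolution Q 0 i j).toReal = (1 : Matrix X X ℝ) i j := by
  rw [← minimalApply_single, minimalApply_zero, Matrix.one_apply, Pi.single_apply]
  split_ifs <;> simp

theorem isMarkovSemigroup_minimalSemigroup (h : HasLyapunov Q S F C) :
    IsMarkovSemigroup (minimalSemigroup Q) where
  nonneg _ _ _ := ENNReal.toReal_nonneg
  rowSum t i := by
    have h1 := hasSum_toReal_of_tsum (h.tsum_minimalSolution t.2 i) ENNReal.one_ne_top
    rwa [ENNReal.toReal_one] at h1
  zero := by
    ext i j
    exact minimalSolution_zero_toReal i j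
  chapmanKolmogorov s t i j := by
    have h1 := hasSum_toReal_of_tsum (h.minimalSolution_add s.2 t.2 i j)
      (ne_top_of_le_ne_top ENNReal.one_ne_top (h.minimalSolution_le_one (s + t).2 i j))
    simp only [ENNReal.toReal_mul] at h1
    exact h1
  standard i j := by
    have h1 := (h.isBackwardSolution_minimalSolution j 0 le_rfl i).continuousWithinAt
    have h2 : Filter.Tendsto (fun s : ℝ => (minimalSolution Q s i j).toReal) (𝓝[>] 0)
        (𝓝 ((1 : Matrix X X ℝ) i j)) := by
      have := h1.tendsto.mono_left (nhdsWithin_mono 0 Set.Ioi_subset_Ici_self)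
      rwa [← minimalSolution_zero_toReal (Q := Q)]
    exact h2.comp tendsto_coe_nhdsGT_zero

theorem hasQMatrix_minimalSemigroup (h : HasLyapunov Q S F C) :
    HasQMatrix (minimalSemigroup Q) Q := by
  intro i j
  have h1 := h.isBackwardSolution_minimalSolution j 0 le_rfl i
  have h2 := (hasDerivWithinAt_iff_tendsto_slope' (by simp)).1 (h1.mono Set.Ioi_subset_Ici_self)
  have h3 : ∑ k ∈ S i, Q i k * (minimalSolution Q 0 k j).toReal = Q i j := by
    simp only [minimalSolution_zero_toReal, Matrix.one_apply, mul_ite, mul_one, mul_zero,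
      Finset.sum_ite_eq']
    split_ifs with hj
    · rfl
    · exact (h.support i j hj).symm
  rw [h3] at h2
  refine (h2.comp tendsto_coe_nhdsGT_zero).congr fun t => ?_
  simp only [Function.comp_apply, slope_def_field, minimalSolution_zero_toReal, sub_zero]
  rfl

/-- A conservative matrix with finite rows and a proper Lyapunov function determines a unique
semigroup. -/
theorem isUniqueSemigroupOf (h : HasLyapunov Q S F C) :
    IsUniqueSemigroupOf (minimalSemigroup Q) Q := by
  have hM := h.isMarkovSemigroup_minimalSemigroup
  refine ⟨hM, h.hasQMatrix_minimalSemigroup, fun P' hP' hQ' => ?_⟩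
  ext t i j
  have h1 := h.eq_of_isBackwardSolution (hP'.isBackwardSolution hQ' h j)
    (hM.isBackwardSolution h.hasQMatrix_minimalSemigroup h j)
    (fun i => by simp [hP'.zero, hM.zero])
    (fun T => ⟨1, fun t _ _ i => hP'.abs_le_one _ i j⟩)
    (fun T => ⟨1, fun t _ _ i => hM.abs_le_one _ i j⟩) t t.2 i
  simpa using h1

end HasLyapunov

end Minimal

/-! ### Comparison with supersolutions and the Feller criterion -/

/-- Comparison of a solution of the backward equation with a stationary supersolution. -/
theorem HasLyapunov.le_exp_mul {X : Type*} {Q : Matrix X X ℝ} {S : X → Finset X} {F : X → ℝ}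
    {C : ℝ} (h : HasLyapunov Q S F C) {u : ℝ → X → ℝ} (hu : IsBackwardSolution Q S u)
    (hB : ∀ T, ∃ B, ∀ t, 0 ≤ t → t ≤ T → ∀ i, u t i ≤ B) {g : X → ℝ} {c : ℝ}
    (hg0 : ∀ i, 0 ≤ g i) (hg : ∀ i, ∑ k ∈ S i, Q i k * g k ≤ c * g i) (h0 : ∀ i, u 0 i ≤ g i)
    {t : ℝ} (ht : 0 ≤ t) (i : X) : u t i ≤ Real.exp (c * t) * g i := by
  have hd : ∀ t : ℝ, HasDerivAt (fun t : ℝ => Real.exp (c * t)) (c * Real.exp (c * t)) t := by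
    intro t
    simpa [mul_comm] using ((hasDerivAt_id t).const_mul c).exp
  have key := h.nonpos_of_subsolution (u := fun t i => u t i - Real.exp (c * t) * g i)
    (d := fun t i => ∑ k ∈ S i, Q i k * u t k - c * Real.exp (c * t) * g i)
    (fun t ht i => (hu t ht i).sub ((hd t).mul_const (g i)).hasDerivWithinAt)
    (fun t _ i => by
      have h1 : ∑ k ∈ S i, Q i k * (u t k - Real.exp (c * t) * g k) =
          ∑ k ∈ S i, Q i k * u t k - Real.exp (c * t) * ∑ k ∈ S i, Q i k * g k := by
        rw [Finset.mul_sum, ← Finset.sum_sub_distrib]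
        exact Finset.sum_congr rfl fun k _ => by ring
      have h2 := mul_le_mul_of_nonneg_left (hg i) (Real.exp_pos (c * t)).le
      rw [h1]
      linarith)
    (fun i => by simpa using h0 i)
    (fun T => by
      obtain ⟨B, hB⟩ := hB T
      exact ⟨B, fun t ht htT i => by
        have := mul_nonneg (Real.exp_pos (c * t)).le (hg0 i)
        linarith [hB t ht htT i]⟩) t ht i
  linarith

section Feller

variable {X : Type*} [DecidableEq X] {P : ℝ≥0 → Matrix X X ℝ}

namespace IsMarkovSemigroup

theorem summable_mul (hP : IsMarkovSemigroup P) {f : X → ℝ} {B : ℝ} (hf : ∀ y, |f y| ≤ B)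
    (t : ℝ≥0) (x : X) : Summable fun y => P t x y * f y := by
  refine Summable.of_norm_bounded ((hP.rowSum t x).summable.mul_right B) fun y => ?_
  rw [norm_mul, Real.norm_of_nonneg (hP.nonneg t x y)]
  exact mul_le_mul_of_nonneg_left (hf y) (hP.nonneg t x y)

/-- The discarded values of f are at most ε and the row has mass 1; the estimate is uniform in t and
x. -/
theorem abs_tsum_sub_sum_le (hP : IsMarkovSemigroup P) {f : X → ℝ} {B ε : ℝ}
    (hf : ∀ y, |f y| ≤ B) {A : Finset X} (hA : ∀ y, y ∉ A → |f y| ≤ ε) (hε : 0 ≤ ε)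
    (t : ℝ≥0) (x : X) : |∑' y, P t x y * f y - ∑ y ∈ A, P t x y * f y| ≤ ε := by
  classical
  have h1 := (hP.summable_mul hf t x).hasSum
  have h2 : HasSum (fun y => P t x y * if y ∈ A then f y else 0) (∑ y ∈ A, P t x y * f y) := by
    have : ∑ y ∈ A, P t x y * f y = ∑ y ∈ A, P t x y * if y ∈ A then f y else 0 :=
      Finset.sum_congr rfl fun y hy => by rw [if_pos hy]
    rw [this]
    exact hasSum_sum_of_ne_finset_zero fun y hy => by rw [if_neg hy, mul_zero]
  have h3 := h1.sub h2
  have h4 := (hP.rowSum t x).mul_right ε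
  have hb : ∀ y, |P t x y * f y - P t x y * (if y ∈ A then f y else 0)| ≤ P t x y * ε := by
    intro y
    rw [← mul_sub, abs_mul, abs_of_nonneg (hP.nonneg t x y)]
    refine mul_le_mul_of_nonneg_left ?_ (hP.nonneg t x y)
    split_ifs with hy
    · simpa using hε
    · simpa using hA y hy
  rw [one_mul] at h4
  exact abs_le.2 ⟨by
    have := hasSum_le (fun y => (abs_le.1 (hb y)).1) h4.neg h3
    exact this, hasSum_le (fun y => (abs_le.1 (hb y)).2) h3 h4⟩

/-- A semigroup whose columns vanish at infinity, uniformly on finite time intervals, is Feller. -/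
theorem isFeller [TopologicalSpace X] [DiscreteTopology X] (hP : IsMarkovSemigroup P)
    (hb : ∀ (T : ℝ≥0) (j : X), ∃ g : X → ℝ, Filter.Tendsto g Filter.cofinite (𝓝 0) ∧
      ∀ t ≤ T, ∀ i, P t i j ≤ g i) : IsFeller P := by
  intro f
  have hfB : ∀ y, |f y| ≤ ‖f.toBCF‖ := fun y => f.toBCF.norm_coe_le_norm y
  set B := ‖f.toBCF‖
  have hB0 : 0 ≤ B := norm_nonneg _
  have hf0 : Filter.Tendsto f Filter.cofinite (𝓝 0) := by
    rw [← Filter.cocompact_eq_cofinite]; exact f.zero_at_infty'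
  have hfA : ∀ ε > 0, ∃ A : Finset X, ∀ y, y ∉ A → |f y| ≤ ε := by
    intro ε hε
    have h1 : {y | ¬ |f y| ≤ ε}.Finite := by
      have := (hf0.abs.eventually_le_const (by simpa using hε) : ∀ᶠ y in Filter.cofinite, |f y| ≤ ε)
      exact Filter.eventually_cofinite.1 this
    exact ⟨h1.toFinset, fun y hy => by simpa using hy⟩
  have hcol : ∀ (t : ℝ≥0) j, Filter.Tendsto (fun i => P t i j) Filter.cofinite (𝓝 0) := by
    intro t j
    obtain ⟨g, hg, hgb⟩ := hb t j
    exact squeeze_zero (fun i => hP.nonneg t i j) (hgb t le_rfl) hg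
  have hPf : ∀ t : ℝ≥0, Filter.Tendsto (fun x => ∑' y, P t x y * f y) Filter.cofinite (𝓝 0) := by
    intro t
    rw [Metric.tendsto_nhds]
    intro ε hε
    obtain ⟨A, hA⟩ := hfA (ε / 2) (half_pos hε)
    have h1 : Filter.Tendsto (fun x => ∑ y ∈ A, P t x y * f y) Filter.cofinite (𝓝 0) := by
      simpa using tendsto_finsetSum A fun y _ => (hcol t y).mul_const (f y)
    filter_upwards [(Metric.tendsto_nhds.1 h1) (ε / 2) (half_pos hε)] with x hx
    have h2 := hP.abs_tsum_sub_sum_le hfB hA (half_pos hε).le t x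
    rw [dist_zero_right, Real.norm_eq_abs] at hx ⊢
    calc _ = |(∑' y, P t x y * f y - ∑ y ∈ A, P t x y * f y) + ∑ y ∈ A, P t x y * f y| := by
          rw [sub_add_cancel]
      _ ≤ _ := abs_add_le _ _
      _ < ε := by linarith
  -- Outside a finite set of rows both entries lie in [0, ε) by the bound g; on the finite set
  -- pointwise continuity suffices.
  have hunif : ∀ (t₀ : ℝ≥0) (j : X), ∀ ε > 0, ∀ᶠ t in 𝓝 t₀, ∀ i,
      |P t i j - P t₀ i j| ≤ ε := by
    intro t₀ j ε hε
    obtain ⟨g, hg, hgb⟩ := hb (t₀ + 1) j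
    have hfin : {i | ¬ g i < ε}.Finite := Filter.eventually_cofinite.1 (hg.eventually_lt_const hε)
    have h1 : ∀ᶠ t in 𝓝 t₀, ∀ i ∈ hfin.toFinset, |P t i j - P t₀ i j| ≤ ε := by
      rw [Filter.eventually_all_finset]
      intro i _
      have := Metric.tendsto_nhds.1 ((hP.continuous_entry i j).tendsto t₀) ε hε
      filter_upwards [this] with t ht
      rw [Real.dist_eq] at ht
      exact ht.le
    have h2 : ∀ᶠ t in 𝓝 t₀, t ≤ t₀ + 1 := by
      filter_upwards [Iio_mem_nhds (lt_add_one t₀)] with t ht using le_of_lt ht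
    filter_upwards [h1, h2] with t ht1 ht2 i
    by_cases hi : i ∈ hfin.toFinset
    · exact ht1 i hi
    · have hgi : g i < ε := by simpa using hi
      have b1 := hgb t ht2 i
      have b2 := hgb t₀ (le_self_add) i
      rw [abs_le]
      constructor <;> linarith [hP.nonneg t i j, hP.nonneg t₀ i j]
  refine ⟨fun t => ⟨⟨fun x => ∑' y, P t x y * f y, continuous_of_discreteTopology⟩, ?_⟩, ?_, ?_⟩
  · rw [Filter.cocompact_eq_cofinite]
    exact hPf t
  · rw [continuous_iff_continuousAt]
    intro t₀
    rw [ContinuousAt, Metric.tendsto_nhds]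
    intro ε hε
    -- Two truncation errors of ε/8 and a finite sum of at most ε/4 give ε/2 < ε.
    obtain ⟨A, hA⟩ := hfA (ε / 8) (by positivity)
    have h1 : ∀ᶠ t in 𝓝 t₀, ∀ y ∈ A, ∀ x,
        |P t x y - P t₀ x y| ≤ ε / (4 * (A.card + 1) * (B + 1)) := by
      rw [Filter.eventually_all_finset]
      exact fun y _ => hunif t₀ y _ (by positivity)
    filter_upwards [h1] with t ht
    refine lt_of_le_of_lt (b := ε / 2) ?_ (half_lt_self hε)
    rw [← ZeroAtInftyContinuousMap.dist_toBCF_eq_dist]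
    refine (BoundedContinuousFunction.dist_le (by positivity)).2 fun x => ?_
    have e1 := hP.abs_tsum_sub_sum_le hfB hA (by positivity) t x
    have e2 := hP.abs_tsum_sub_sum_le hfB hA (by positivity) t₀ x
    have e3 : |∑ y ∈ A, P t x y * f y - ∑ y ∈ A, P t₀ x y * f y| ≤ ε / 4 := by
      rw [← Finset.sum_sub_distrib]
      calc _ ≤ ∑ y ∈ A, |P t x y * f y - P t₀ x y * f y| := Finset.abs_sum_le_sum_abs _ _
        _ ≤ ∑ y ∈ A, ε / (4 * (A.card + 1) * (B + 1)) * (B + 1) := by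
          refine Finset.sum_le_sum fun y hy => ?_
          rw [← sub_mul, abs_mul]
          exact mul_le_mul (ht y hy x) ((hfB y).trans (by linarith)) (abs_nonneg _)
            (by positivity)
        _ = A.card * (ε / (4 * (A.card + 1))) := by
          rw [Finset.sum_const, nsmul_eq_mul]
          field_simp
        _ ≤ ε / 4 := by
          rw [mul_div_assoc', div_le_div_iff₀ (by positivity) (by positivity)]
          nlinarith [hε, (Nat.cast_nonneg A.card : (0 : ℝ) ≤ A.card)]
    change dist (∑' y, P t x y * f y) (∑' y, P t₀ x y * f y) ≤ ε / 2
    rw [Real.dist_eq]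
    rw [abs_le] at e1 e2 e3 ⊢
    constructor <;> linarith [e1.1, e1.2, e2.1, e2.2, e3.1, e3.2]
  · exact fun t x => (hP.summable_mul hfB t x).hasSum

end IsMarkovSemigroup

end Feller

/-! ### The one-particle generator on the Newton basis -/

/-- The Newton basis `∏_{k < m} (y² - (k + e)²)` of the even polynomials in `y`. -/
noncomputable def newtonPoly (e : ℝ) (m : ℕ) (y : ℝ) : ℝ :=
  ∏ k ∈ Finset.range m, (y ^ 2 - (k + e) ^ 2)

theorem newtonPoly_zero (e y : ℝ) : newtonPoly e 0 y = 1 := by simp [newtonPoly]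

theorem newtonPoly_succ (e : ℝ) (m : ℕ) (y : ℝ) :
    newtonPoly e (m + 1) y = newtonPoly e m y * (y ^ 2 - (m + e) ^ 2) :=
  Finset.prod_range_succ _ _

theorem newtonPoly_neg (e : ℝ) (m : ℕ) (y : ℝ) : newtonPoly e m (-y) = newtonPoly e m y := by
  simp [newtonPoly]

/-- Each factor splits as (y-k-e)(y+k+e), and the shift y ↦ y+1 moves both strings of linear factors
by one place; multiplying by y+e avoids a division. -/
theorem mul_newtonPoly_add_one (e : ℝ) (m : ℕ) (y : ℝ) :
    (y + e) * newtonPoly e (m + 1) (y + 1) =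
      (y + 1 - e) * (y + e + m + 1) * (y + e + m) * newtonPoly e m y := by
  induction m with
  | zero => simp [newtonPoly_succ, newtonPoly_zero]; ring
  | succ m ih =>
    rw [newtonPoly_succ, newtonPoly_succ e m y]
    push_cast
    linear_combination ((y + 1) ^ 2 - (m + 1 + e) ^ 2) * ih

/-- The difference produces 2y+1, which cancels the denominator 2x+2ε+1 of the birth rate, while y+e
= x+2ε is one of its factors. At -y the same identity serves the death rate. -/
theorem mul_newtonPoly_sub (e : ℝ) (m : ℕ) (y : ℝ) :
    (y + e) * (newtonPoly e (m + 1) (y + 1) - newtonPoly e (m + 1) y) =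
      (m + 1) * (2 * y + 1) * (y + e + m) * newtonPoly e m y := by
  rw [mul_sub, mul_newtonPoly_add_one, newtonPoly_succ]
  ring

/-- The generator of the birth-and-death process. -/
noncomputable def bdGen (a b : ℝ) (u u' : ℂ) (φ : ℕ → ℝ) (x : ℕ) : ℝ :=
  birthRate a b u u' x * (φ (x + 1) - φ x) + deathRate a b u u' x * (φ (x - 1) - φ x)

theorem rateMatrix_eq_zero (a b : ℝ) (u u' : ℂ) {x y : ℕ} (h1 : y ≠ x + 1) (h2 : x ≠ y + 1)
    (h3 : x ≠ y) : rateMatrix a b u u' x y = 0 := by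
  simp [rateMatrix, h1, h2, h3]

theorem sum_rateMatrix_mul (a b : ℝ) (u u' : ℂ) (φ : ℕ → ℝ) (x : ℕ) :
    ∑ y ∈ Finset.range (x + 2), rateMatrix a b u u' x y * φ y = bdGen a b u u' φ x := by
  rw [Finset.sum_range_succ, Finset.sum_range_succ]
  have e1 : rateMatrix a b u u' x (x + 1) = birthRate a b u u' x := by simp [rateMatrix]
  have e2 : rateMatrix a b u u' x x = -(birthRate a b u u' x + deathRate a b u u' x) := by
    simp [rateMatrix]
  rcases x with _ | x
  · simp only [Finset.range_zero, Finset.sum_empty, e1, e2, bdGen]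
    simp [deathRate]
    ring
  · have e3 : rateMatrix a b u u' (x + 1) x = deathRate a b u u' (x + 1) := by
      rw [rateMatrix, if_neg (by omega), if_pos rfl]
    rw [Finset.sum_range_succ, Finset.sum_eq_zero, e1, e2, e3, bdGen]
    · simp only [Nat.add_sub_cancel]; ring
    · intro y hy
      rw [Finset.mem_range] at hy
      rw [rateMatrix_eq_zero _ _ _ _ (by omega) (by omega) (by omega), zero_mul]

theorem re_birth_factor (u u' : ℂ) (x : ℝ) :
    (((x : ℂ) - u) * ((x : ℂ) - u')).re = x ^ 2 - x * (u + u').re + (u * u').re := by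
  simp [Complex.mul_re, Complex.add_re]; ring

theorem re_death_factor (u u' : ℂ) (x : ℝ) :
    (((x : ℂ) + u) * ((x : ℂ) + u')).re = x ^ 2 + x * (u + u').re + (u * u').re := by
  simp [Complex.mul_re, Complex.add_re]; ring

/-- The off-diagonal coefficient of the generator in the Newton basis. -/
noncomputable def newtonCoeff (a b : ℝ) (u u' : ℂ) (m : ℕ) : ℝ :=
  (m + 1) * ((m - ((u + u').re + b)) * (m + eps a b) ^ 2 +
    ((a + 1 + m) * (eps a b ^ 2 + eps a b * (u + u').re + (u * u').re) -
      (a + 1 - eps a b) * (eps a b + m) * (2 * eps a b + (u + u').re)))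

section

variable {a b : ℝ} {u u' : ℂ}

theorem eps_nonneg (hab : b ≤ a) (hb : -(1 / 2) ≤ b) : 0 ≤ eps a b := by
  unfold eps; linarith

theorem birthRate_eq {x : ℕ} (hx : x ≠ 0) : birthRate a b u u' x =
    (x + 2 * eps a b) * (x + a + 1) * ((x : ℝ) ^ 2 - x * (u + u').re + (u * u').re) /
    (2 * (x + eps a b) * (2 * x + 2 * eps a b + 1)) := by
  have := re_birth_factor u u' x
  simp only [Complex.ofReal_natCast] at this
  rw [birthRate, if_neg hx, this]

theorem deathRate_eq {x : ℕ} (hx : x ≠ 0) : deathRate a b u u' x =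
    x * (x + b) * ((x + 2 * eps a b) ^ 2 + (x + 2 * eps a b) * (u + u').re + (u * u').re) /
    (2 * (x + eps a b) * (2 * x + 2 * eps a b - 1)) := by
  have := re_death_factor u u' (x + 2 * eps a b)
  push_cast at this
  rw [deathRate, if_neg hx, ← this]
  congr 4 <;> ring

/-- The generator acts on the Newton basis by a bidiagonal matrix. -/
theorem bdGen_newtonPoly (hab : b ≤ a) (hb : -(1 / 2) ≤ b) (m x : ℕ) :
    bdGen a b u u' (fun x => newtonPoly (eps a b) (m + 1) (x + eps a b)) x =
      (m + 1) * (m - ((u + u').re + b)) * newtonPoly (eps a b) (m + 1) (x + eps a b) +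
        newtonCoeff a b u u' m * newtonPoly (eps a b) m (x + eps a b) := by
  have he := eps_nonneg hab hb
  have hba : b = 2 * eps a b - a - 1 := by unfold eps; ring
  set e := eps a b with hedef
  -- At x = 0 the birth rate has its cancelled form and y = ε may vanish, so the computation below
  -- would divide by zero.
  rcases Nat.eq_zero_or_pos x with rfl | hx
  · have hd : deathRate a b u u' 0 = 0 := by simp [deathRate]
    have hz : ∀ k, newtonPoly e (k + 1) e = 0 := fun k =>
      Finset.prod_eq_zero (Finset.mem_range.2 (Nat.succ_pos k)) (by simp)
    have hβ : birthRate a b u u' 0 * (2 * e + 1) = (a + 1) * (u * u').re := by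
      rw [birthRate, if_pos rfl, ← hedef, div_mul_cancel₀]
      linarith
    simp only [bdGen, hd, zero_mul, add_zero, zero_add, Nat.cast_zero, hz, mul_zero, sub_zero]
    generalize birthRate a b u u' 0 = β at hβ ⊢
    rcases m with _ | m
    · simp only [newtonPoly_succ, newtonPoly_zero, newtonCoeff, ← hedef]
      rw [hba]
      push_cast
      linear_combination hβ
    · have h1 : newtonPoly e (m + 1 + 1) (((0 + 1 : ℕ) : ℝ) + e) = 0 :=
        Finset.prod_eq_zero (i := 1) (Finset.mem_range.2 (by omega)) (by simp)
      rw [hz, mul_zero]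
      simp only [zero_add] at h1
      rw [h1, mul_zero]
  · have hx0 : x ≠ 0 := hx.ne'
    have hx1 : (1 : ℝ) ≤ x := by exact_mod_cast hx
    have hc1 : ((x + 1 : ℕ) : ℝ) + e = (x + e) + 1 := by push_cast; ring
    -- By evenness of the Newton polynomials, a step down from y is a step up from -y.
    have hc2 : ((x - 1 : ℕ) : ℝ) + e = -(-(x + e) + 1) := by
      rw [Nat.cast_sub hx]; push_cast; ring
    simp only [bdGen, hc1, hc2, newtonPoly_neg]
    rw [birthRate_eq hx0, deathRate_eq hx0, ← hedef]
    have hP := mul_newtonPoly_sub e m (x + e)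
    have hM := mul_newtonPoly_sub e m (-(x + e))
    rw [newtonPoly_neg, newtonPoly_neg] at hM
    set y : ℝ := x + e with hy
    have hxy : (x : ℝ) = y - e := by rw [hy]; ring
    have hy0 : y ≠ 0 := by rw [hy]; positivity
    have hy1 : 2 * y + 1 ≠ 0 := by rw [hy]; positivity
    have hy2 : 2 * y - 1 ≠ 0 := by
      have : 0 < 2 * y - 1 := by rw [hy]; linarith
      exact this.ne'
    set p := newtonPoly e m y
    set Bf : ℝ := (y - e) ^ 2 - (y - e) * (u + u').re + (u * u').re with hBf
    set Df : ℝ := (y + e) ^ 2 + (y + e) * (u + u').re + (u * u').re with hDf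
    -- Only 2y remains as denominator in `t1` and `t2`. Their sum is (g(y) - g(-y))/(2y) for a
    -- polynomial g times the even factor p, so this denominator cancels too.
    have t1 : ((x : ℝ) + 2 * e) * (x + a + 1) * ((x : ℝ) ^ 2 - x * (u + u').re + (u * u').re) /
        (2 * y * (2 * x + 2 * e + 1)) *
        (newtonPoly e (m + 1) (y + 1) - newtonPoly e (m + 1) y) =
        (y - e + a + 1) * Bf * ((m + 1) * (y + e + m) * p) / (2 * y) := by
      have : ((x : ℝ) + 2 * e) * (x + a + 1) * ((x : ℝ) ^ 2 - x * (u + u').re + (u * u').re) /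
        (2 * y * (2 * x + 2 * e + 1)) *
        (newtonPoly e (m + 1) (y + 1) - newtonPoly e (m + 1) y) = (y - e + a + 1) * Bf *
        ((y + e) * (newtonPoly e (m + 1) (y + 1) - newtonPoly e (m + 1) y)) /
          (2 * y * (2 * y + 1)) := by
        rw [hBf, hxy]; ring
      rw [this, hP, div_eq_div_iff (by positivity) (by positivity)]
      ring
    have t2 : (x : ℝ) * (x + b) * ((x + 2 * e) ^ 2 + (x + 2 * e) * (u + u').re + (u * u').re) /
        (2 * y * (2 * x + 2 * e - 1)) *
        (newtonPoly e (m + 1) (-y + 1) - newtonPoly e (m + 1) y) =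
        -((y + e - a - 1) * Df * ((m + 1) * (y - e - m) * p) / (2 * y)) := by
      have : (x : ℝ) * (x + b) * ((x + 2 * e) ^ 2 + (x + 2 * e) * (u + u').re + (u * u').re) /
        (2 * y * (2 * x + 2 * e - 1)) *
        (newtonPoly e (m + 1) (-y + 1) - newtonPoly e (m + 1) y) = -((y + e - a - 1) * Df *
        ((-y + e) * (newtonPoly e (m + 1) (-y + 1) - newtonPoly e (m + 1) y)) /
          (2 * y * (2 * y - 1))) := by
        rw [hDf, hxy, hba]; ring
      rw [this, hM, neg_inj, div_eq_div_iff (by positivity) (by positivity)]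
      ring
    rw [t1, t2, newtonPoly_succ, newtonCoeff, ← hedef, hba, hBf, hDf]
    field_simp
    ring

theorem bdGen_const (c : ℝ) (x : ℕ) : bdGen a b u u' (fun _ => c) x = 0 := by simp [bdGen]

theorem bdGen_add (φ ψ : ℕ → ℝ) (x : ℕ) :
    bdGen a b u u' (fun x => φ x + ψ x) x = bdGen a b u u' φ x + bdGen a b u u' ψ x := by
  simp only [bdGen]; ring

theorem birthRate_nonneg (hab : b ≤ a) (hb : -(1 / 2) ≤ b) (hu : (u, u') ∈ admissible a b)
    (x : ℕ) : 0 ≤ birthRate a b u u' x := by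
  have he := eps_nonneg hab hb
  have h1 := (Complex.pos_iff.1 (hu.1 x)).1
  simp only at h1
  rcases Nat.eq_zero_or_pos x with rfl | hx
  · rw [birthRate, if_pos rfl]
    simp only [Nat.cast_zero, sub_zero] at h1
    have : 0 ≤ a + 1 := by linarith
    positivity
  · have h2 : (((x : ℂ) - u) * (x - u')) = (u - x) * (u' - x) := by ring
    rw [birthRate, if_neg hx.ne', h2]
    have hx1 : (1 : ℝ) ≤ x := by exact_mod_cast hx
    have : 0 ≤ (x : ℝ) + a + 1 := by linarith
    positivity

theorem deathRate_nonneg (hab : b ≤ a) (hb : -(1 / 2) ≤ b) (hu : (u, u') ∈ admissible a b)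
    (x : ℕ) : 0 ≤ deathRate a b u u' x := by
  have he := eps_nonneg hab hb
  rcases Nat.eq_zero_or_pos x with rfl | hx
  · simp [deathRate]
  · have h1 := (Complex.pos_iff.1 (hu.2.1 x hx)).1
    simp only at h1
    have h2 : (((x : ℂ) + u + 2 * (eps a b : ℂ)) * (x + u' + 2 * (eps a b : ℂ))) =
      (u + x + 2 * (eps a b : ℂ)) * (u' + x + 2 * (eps a b : ℂ)) := by ring
    rw [deathRate, if_neg hx.ne', h2]
    have hx1 : (1 : ℝ) ≤ x := by exact_mod_cast hx
    have : 0 ≤ (x : ℝ) + b := by linarith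
    have : 0 ≤ 2 * (x : ℝ) + 2 * eps a b - 1 := by linarith
    positivity

theorem rateMatrix_nonneg (hab : b ≤ a) (hb : -(1 / 2) ≤ b) (hu : (u, u') ∈ admissible a b)
    {x y : ℕ} (hxy : x ≠ y) : 0 ≤ rateMatrix a b u u' x y := by
  unfold rateMatrix
  split_ifs
  · exact birthRate_nonneg hab hb hu x
  · exact deathRate_nonneg hab hb hu x
  · exact le_rfl

/-! ### Growth estimates for one particle -/

theorem bdGen_sq (hab : b ≤ a) (hb : -(1 / 2) ≤ b) (x : ℕ) :
    bdGen a b u u' (fun x => ((x : ℝ) + eps a b) ^ 2) x =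
      -((u + u').re + b) * ((x + eps a b) ^ 2 - eps a b ^ 2) + newtonCoeff a b u u' 0 := by
  have h1 := bdGen_newtonPoly (u := u) (u' := u') hab hb 0 x
  simp only [newtonPoly_succ, newtonPoly_zero, one_mul, Nat.cast_zero, zero_add, zero_sub,
    mul_one] at h1
  rw [← h1]
  simp only [bdGen]
  ring

/-- The squared increments of `(x + ε)²` have mean of order `(x + ε)⁴`. -/
theorem exists_carre_du_champ_le (hab : b ≤ a) (hb : -(1 / 2) ≤ b) : ∃ K : ℝ, ∀ x : ℕ,
    birthRate a b u u' x * (((x + 1 : ℕ) + eps a b) ^ 2 - (x + eps a b) ^ 2) ^ 2 +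
      deathRate a b u u' x * (((x - 1 : ℕ) + eps a b) ^ 2 - (x + eps a b) ^ 2) ^ 2 ≤
      K * ((x + eps a b) ^ 2 + 1) ^ 2 := by
  have he := eps_nonneg hab hb
  set e := eps a b with hedef
  set s := (u + u').re + b with hs
  set k0 := newtonCoeff a b u u' 0
  set k1 := newtonCoeff a b u u' 1
  refine ⟨|2 * (1 - s) + 2 * s| + |-2 * (1 - s) * (1 + 2 * e) + k1 - s * (1 + 2 * e) - 2 * k0| +
    |(1 + 2 * e) * k0|, fun x => ?_⟩
  have h1 := bdGen_newtonPoly (u := u) (u' := u') hab hb 0 x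
  have h2 := bdGen_newtonPoly (u := u) (u' := u') hab hb 1 x
  simp only [newtonPoly_succ, newtonPoly_zero, one_mul, Nat.cast_zero, zero_add, zero_sub,
    mul_one, Nat.cast_one, ← hedef, ← hs, bdGen] at h1 h2
  set z : ℝ := ((x : ℝ) + e) ^ 2 - e ^ 2 with hz
  have hz0 : 0 ≤ z :=
    sub_nonneg.2 (pow_le_pow_left₀ he (by linarith [(Nat.cast_nonneg x : (0 : ℝ) ≤ x)]) 2)
  -- The left side is L(z²) - 2zLz for the generator L, and z² is the Newton polynomial of degree 2
  -- plus (1+2e)z; so it is a quadratic polynomial in z.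
  have key : birthRate a b u u' x * (((x + 1 : ℕ) + e) ^ 2 - (x + e) ^ 2) ^ 2 +
      deathRate a b u u' x * (((x - 1 : ℕ) + e) ^ 2 - (x + e) ^ 2) ^ 2 =
      (2 * (1 - s) + 2 * s) * z ^ 2 +
      (-2 * (1 - s) * (1 + 2 * e) + k1 - s * (1 + 2 * e) - 2 * k0) * z + (1 + 2 * e) * k0 := by
    have hzz : ((x : ℝ) + e) ^ 2 = z + e ^ 2 := by rw [hz]; ring
    rw [hzz] at h2 ⊢
    linear_combination h2 + (1 + 2 * e - 2 * z) * h1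
  rw [key]
  have hzF : z ≤ (x + e) ^ 2 + 1 := by rw [hz]; linarith [sq_nonneg e]
  have hF1 : 1 ≤ ((x : ℝ) + e) ^ 2 + 1 := by linarith [sq_nonneg ((x : ℝ) + e)]
  have b1 : z ^ 2 ≤ ((x + e) ^ 2 + 1) ^ 2 := by gcongr
  have b2 : z ≤ ((x + e) ^ 2 + 1) ^ 2 := hzF.trans (le_self_pow₀ hF1 two_ne_zero)
  have b3 : 1 ≤ (((x : ℝ) + e) ^ 2 + 1) ^ 2 := one_le_pow₀ hF1
  have c1 : ∀ A w W : ℝ, 0 ≤ w → w ≤ W → A * w ≤ |A| * W := fun A w W hw hW =>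
    (mul_le_mul_of_nonneg_right (le_abs_self A) hw).trans
      (mul_le_mul_of_nonneg_left hW (abs_nonneg A))
  have d1 := c1 (2 * (1 - s) + 2 * s) _ _ (sq_nonneg z) b1
  have d2 := c1 (-2 * (1 - s) * (1 + 2 * e) + k1 - s * (1 + 2 * e) - 2 * k0) _ _ hz0 b2
  have d3 := c1 ((1 + 2 * e) * k0) _ _ zero_le_one b3
  linarith

/-- The function `1 / ((x + ε)² + 1)`, vanishing at infinity, is a supersolution. -/
theorem exists_bdGen_inv_le (hab : b ≤ a) (hb : -(1 / 2) ≤ b) (hu : (u, u') ∈ admissible a b) :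
    ∃ c : ℝ, ∀ x : ℕ, bdGen a b u u' (fun x => (((x : ℝ) + eps a b) ^ 2 + 1)⁻¹) x ≤
      c * (((x : ℝ) + eps a b) ^ 2 + 1)⁻¹ := by
  have he := eps_nonneg hab hb
  obtain ⟨K, hK⟩ := exists_carre_du_champ_le (u := u) (u' := u') hab hb
  set s := (u + u').re + b with hs
  set k0 := newtonCoeff a b u u' 0
  refine ⟨|s| + |k0| + 4 * K, fun x => ?_⟩
  have hgen := bdGen_sq (u := u) (u' := u') hab hb x
  have hKx := hK x
  have hβ := birthRate_nonneg hab hb hu x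
  have hδ := deathRate_nonneg hab hb hu x
  have hx0 : (0 : ℝ) ≤ x := Nat.cast_nonneg x
  simp only [bdGen, ← hs] at hgen ⊢
  set e := eps a b
  set β := birthRate a b u u' x
  set δ := deathRate a b u u' x
  -- Expansion of 1/B around A to second order. The generator then gives -(LA)/A² plus 4/A³ times
  -- the squared-increment sum; the latter is O(A²) and LA is O(A), so the total is O(1/A). The
  -- factor 4 covers a step down: 4((y-1)²+1) - (y²+1) = ((3y-4)²+5)/3 > 0.
  have hinv : ∀ A B : ℝ, 0 < A → 0 < B → A ≤ 4 * B →
      B⁻¹ - A⁻¹ ≤ -(B - A) / A ^ 2 + 4 * (B - A) ^ 2 / A ^ 3 := by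
    intro A B hA hB hAB
    have h1 : B⁻¹ - A⁻¹ = -(B - A) / A ^ 2 + (B - A) ^ 2 / A ^ 2 * B⁻¹ := by
      field_simp; ring
    have h2 : B⁻¹ ≤ 4 / A := by
      rw [inv_le_comm₀ hB (by positivity), inv_div, div_le_iff₀ (by norm_num)]
      linarith
    have h3 : (B - A) ^ 2 / A ^ 2 * B⁻¹ ≤ (B - A) ^ 2 / A ^ 2 * (4 / A) := by gcongr
    have h4 : (B - A) ^ 2 / A ^ 2 * (4 / A) = 4 * (B - A) ^ 2 / A ^ 3 := by field_simp
    linarith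
  set A : ℝ := ((x : ℝ) + e) ^ 2 + 1 with hA
  have hA1 : 1 ≤ A := by linarith [sq_nonneg ((x : ℝ) + e)]
  set B₁ : ℝ := (((x + 1 : ℕ) : ℝ) + e) ^ 2 + 1 with hB1
  set B₂ : ℝ := (((x - 1 : ℕ) : ℝ) + e) ^ 2 + 1 with hB2
  have i1 := hinv A B₁ (by positivity) (by positivity) (by
    rw [hA, hB1]; push_cast; nlinarith)
  have i2 := hinv A B₂ (by positivity) (by positivity) (by
    rw [hA, hB2]
    rcases Nat.eq_zero_or_pos x with hx | hx
    · subst hx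
      simp only [CharP.cast_eq_zero, zero_tsub, zero_add]
      linarith [sq_nonneg e]
    · rw [Nat.cast_sub hx]; push_cast; nlinarith [sq_nonneg (3 * ((x : ℝ) + e) - 4)])
  have j1 := mul_le_mul_of_nonneg_left i1 hβ
  have j2 := mul_le_mul_of_nonneg_left i2 hδ
  have hgen' : β * (B₁ - A) + δ * (B₂ - A) = -s * (A - 1 - e ^ 2) + k0 := by
    rw [hA, hB1, hB2]; linear_combination hgen
  have hK' : β * (B₁ - A) ^ 2 + δ * (B₂ - A) ^ 2 ≤ K * A ^ 2 := by
    rw [hA, hB1, hB2]; simpa only [add_sub_add_right_eq_sub] using hKx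
  have hz0 : 0 ≤ A - 1 - e ^ 2 := by
    have : e ^ 2 ≤ ((x : ℝ) + e) ^ 2 := pow_le_pow_left₀ he (by linarith) 2
    linarith
  have hlin : -(-s * (A - 1 - e ^ 2) + k0) ≤ (|s| + |k0|) * A := by
    have h1 : s * (A - 1 - e ^ 2) ≤ |s| * A :=
      (mul_le_mul_of_nonneg_right (le_abs_self s) hz0).trans
        (mul_le_mul_of_nonneg_left (by linarith [sq_nonneg e]) (abs_nonneg s))
    have h2 : -k0 ≤ |k0| * A :=
      (neg_le_abs k0).trans (le_mul_of_one_le_right (abs_nonneg k0) hA1)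
    linarith
  calc _ ≤ β * (-(B₁ - A) / A ^ 2 + 4 * (B₁ - A) ^ 2 / A ^ 3) +
        δ * (-(B₂ - A) / A ^ 2 + 4 * (B₂ - A) ^ 2 / A ^ 3) := add_le_add j1 j2
    _ = -(β * (B₁ - A) + δ * (B₂ - A)) / A ^ 2 +
        4 * (β * (B₁ - A) ^ 2 + δ * (B₂ - A) ^ 2) / A ^ 3 := by ring
    _ ≤ ((|s| + |k0|) * A) / A ^ 2 + 4 * (K * A ^ 2) / A ^ 3 := by
        rw [hgen']
        gcongr
    _ = _ := by field_simp

theorem hasLyapunov_rateMatrix (hab : b ≤ a) (hb : -(1 / 2) ≤ b)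
    (hu : (u, u') ∈ admissible a b) : ∃ C, HasLyapunov (rateMatrix a b u u')
      (fun x => Finset.range (x + 2)) (fun x => ((x : ℝ) + eps a b) ^ 2 + 1) C := by
  have he := eps_nonneg hab hb
  refine ⟨|(u + u').re + b| + |newtonCoeff a b u u' 0|, ?_, ?_, ?_, ?_, ?_, ?_⟩
  · exact fun i j hij => rateMatrix_nonneg hab hb hu hij
  · intro i j hj
    rw [Finset.mem_range] at hj
    exact rateMatrix_eq_zero _ _ _ _ (by omega) (by omega) (by omega)
  · intro i
    have := sum_rateMatrix_mul a b u u' (fun _ => 1) i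
    simpa only [mul_one, bdGen_const] using this
  · intro i
    nlinarith
  · intro c
    refine (Set.finite_Iic ⌊c⌋₊).subset fun x hx => ?_
    have hx' : ((x : ℝ) + eps a b) ^ 2 + 1 ≤ c := hx
    exact Nat.le_floor (by nlinarith [(Nat.cast_nonneg x : (0 : ℝ) ≤ x)])
  · intro x
    rw [sum_rateMatrix_mul, bdGen_add, bdGen_const, add_zero, bdGen_sq hab hb]
    set s := (u + u').re + b
    set k0 := newtonCoeff a b u u' 0
    set A : ℝ := ((x : ℝ) + eps a b) ^ 2
    have hA : 0 ≤ A - eps a b ^ 2 := by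
      simp only [A]; nlinarith [(Nat.cast_nonneg x : (0 : ℝ) ≤ x)]
    have h1 : -s * (A - eps a b ^ 2) ≤ |s| * (A + 1) :=
      (mul_le_mul_of_nonneg_right (neg_le_abs s) hA).trans
        (mul_le_mul_of_nonneg_left (by nlinarith) (abs_nonneg s))
    have h2 : k0 ≤ |k0| * (A + 1) := by
      have : 0 ≤ A := by nlinarith
      nlinarith [le_abs_self k0, abs_nonneg k0]
    linarith

end

/-! ### Determinants: row and column derivatives, Newton determinants -/

section Determinants

variable {n : Type*} [DecidableEq n] [Fintype n]

/-- Both sides equal tr(adj(M) M'). The generator acts on variables (rows), the bidiagonal relation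
on degrees (columns); this identity passes between them. -/
theorem sum_det_updateRow_eq_sum_det_updateCol {R : Type*} [CommRing R] (M M' : Matrix n n R) :
    ∑ i, (M.updateRow i (M' i)).det = ∑ j, (M.updateCol j fun i => M' i j).det := by
  have h1 : ∀ i, (M.updateRow i (M' i)).det = ∑ j, M.adjugate j i * M' i j := by
    intro i
    rw [← Matrix.cramer_transpose_apply, Matrix.cramer_eq_adjugate_mulVec,
      ← Matrix.adjugate_transpose]
    rfl
  have h2 : ∀ j, (M.updateCol j fun i => M' i j).det = ∑ i, M.adjugate j i * M' i j := by
    intro j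
    rw [← Matrix.cramer_apply, Matrix.cramer_eq_adjugate_mulVec]
    rfl
  simp only [h1, h2]
  exact Finset.sum_comm

theorem hasDerivWithinAt_det {M : ℝ → Matrix n n ℝ} {M' : Matrix n n ℝ} {s : Set ℝ} {t : ℝ}
    (h : ∀ i j, HasDerivWithinAt (fun t => M t i j) (M' i j) s t) :
    HasDerivWithinAt (fun t => (M t).det) (∑ i, ((M t).updateRow i (M' i)).det) s t := by
  rw [sum_det_updateRow_eq_sum_det_updateCol]
  simp only [Matrix.det_apply']
  rw [Finset.sum_comm]
  refine HasDerivWithinAt.fun_sum fun σ _ => ?_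
  rw [← Finset.mul_sum]
  refine HasDerivWithinAt.const_mul _ ?_
  refine (HasDerivWithinAt.fun_finsetProd fun i _ => h (σ i) i).congr_deriv ?_
  refine Finset.sum_congr rfl fun j _ => ?_
  rw [← Finset.mul_prod_erase Finset.univ _ (Finset.mem_univ j), Matrix.updateCol_self,
    smul_eq_mul, mul_comm]
  congr 1
  exact Finset.prod_congr rfl fun i hi => by
    rw [Matrix.updateCol_ne (Finset.ne_of_mem_erase hi)]

/-- Each term of the Leibniz expansion has one factor from row i, and its other factors are at most
1. -/
theorem abs_det_le_of_row {A : Matrix n n ℝ} (hA : ∀ i j, |A i j| ≤ 1) {i : n} {x : ℝ}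
    (hi : ∀ j, |A i j| ≤ x) : |A.det| ≤ (Fintype.card n).factorial * x := by
  rw [← Matrix.det_transpose, Matrix.det_apply']
  calc _ ≤ ∑ σ : Equiv.Perm n, |((Equiv.Perm.sign σ : ℤ) : ℝ) * ∏ k, A.transpose (σ k) k| :=
        Finset.abs_sum_le_sum_abs _ _
    _ ≤ ∑ σ : Equiv.Perm n, x := by
      refine Finset.sum_le_sum fun σ _ => ?_
      have hs : |((Equiv.Perm.sign σ : ℤ) : ℝ)| = 1 := by
        rcases Int.units_eq_one_or (Equiv.Perm.sign σ) with h | h <;> simp [h]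
      rw [abs_mul, hs, one_mul, Finset.abs_prod,
        ← Finset.mul_prod_erase Finset.univ _ (Finset.mem_univ i)]
      refine (mul_le_of_le_one_right (abs_nonneg _) ?_).trans (hi (σ i))
      exact Finset.prod_le_one (fun _ _ => abs_nonneg _) fun k _ => hA k (σ k)
    _ = _ := by
      rw [Finset.sum_const, Finset.card_univ, Fintype.card_perm, nsmul_eq_mul]

end Determinants

variable {N : ℕ}

/-- The determinant of Newton polynomials of degrees `d j` at the points `x i`. -/
noncomputable def newtonDet (e : ℝ) (d : Fin N → ℕ) (x : Fin N → ℝ) : ℝ :=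
  (Matrix.of fun i j => newtonPoly e (d j) (x i)).det

theorem newtonDet_eq_zero (e : ℝ) {d : Fin N → ℕ} (x : Fin N → ℝ) {j k : Fin N} (hjk : j ≠ k)
    (hd : d j = d k) : newtonDet e d x = 0 :=
  Matrix.det_zero_of_column_eq hjk fun i => by simp [hd]

theorem det_updateCol_newton (e : ℝ) (d : Fin N → ℕ) (x : Fin N → ℝ) (j : Fin N) (k : ℕ) :
    ((Matrix.of fun i j => newtonPoly e (d j) (x i)).updateCol j
      fun i => newtonPoly e k (x i)).det = newtonDet e (Function.update d j k) x := by
  rw [newtonDet]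
  congr 1
  ext i l
  by_cases hl : l = j
  · subst hl; simp
  · simp [Matrix.updateCol_ne hl, Function.update_of_ne hl]

/-- A bidiagonal operator on the Newton basis, acting on a determinant row by row. -/
theorem sum_det_updateRow_newton (e : ℝ) (d : Fin N → ℕ) (x : Fin N → ℝ)
    (M' : Matrix (Fin N) (Fin N) ℝ) (γ κ : Fin N → ℝ) (d' : Fin N → ℕ)
    (hM' : ∀ i j, M' i j = γ j * newtonPoly e (d j) (x i) + κ j * newtonPoly e (d' j) (x i)) :
    ∑ i, ((Matrix.of fun i j => newtonPoly e (d j) (x i)).updateRow i (M' i)).det =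
      (∑ j, γ j) * newtonDet e d x +
        ∑ j, κ j * newtonDet e (Function.update d j (d' j)) x := by
  rw [sum_det_updateRow_eq_sum_det_updateCol, Finset.sum_mul, ← Finset.sum_add_distrib]
  refine Finset.sum_congr rfl fun j _ => ?_
  have h1 : (fun i => M' i j) = (γ j • fun i => newtonPoly e (d j) (x i)) +
      (κ j • fun i => newtonPoly e (d' j) (x i)) := by
    ext i; simp [hM']
  rw [h1, Matrix.det_updateCol_add, Matrix.det_updateCol_smul, Matrix.det_updateCol_smul,
    det_updateCol_newton, det_updateCol_newton, Function.update_eq_self]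

/-- Newton polynomials are monic in x², so column operations reduce the determinant to a
Vandermonde. -/
theorem newtonDet_rev (e : ℝ) (x : Fin N → ℝ) :
    newtonDet e (fun j => N - 1 - (j : ℕ)) x = vdm fun i => x i ^ 2 := by
  have hrev : ∀ j : Fin N, N - 1 - (j : ℕ) = (Fin.rev j : ℕ) := by
    intro j; rw [Fin.val_rev]; omega
  set p : Fin N → Polynomial ℝ := fun j =>
    ∏ k ∈ Finset.range j, (Polynomial.X - Polynomial.C ((k + e) ^ 2)) with hp
  have h1 := Matrix.det_eval_matrixOfPolynomials_eq_det_vandermonde (fun i => x i ^ 2) p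
    (fun i => by
      rw [hp]
      simp only
      rw [Polynomial.natDegree_finsetProd_X_sub_C_eq_card, Finset.card_range])
    (fun i => Polynomial.monic_prod_X_sub_C _ _)
  -- The projective Vandermonde with first argument 1 lists powers in decreasing order, and its
  -- product has factors x_i² - x_j² for i < j, the sign convention of `vdm`.
  have h2 := Matrix.det_projVandermonde (fun _ : Fin N => (1 : ℝ)) (fun i => x i ^ 2)
  have e1 : (Matrix.of fun i j : Fin N => newtonPoly e (N - 1 - (j : ℕ)) (x i)) =
      (Matrix.of fun i j => Polynomial.eval (x i ^ 2) (p j)).submatrix id Fin.revPerm := by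
    ext i j
    simp only [Matrix.of_apply, Matrix.submatrix_apply, id, Fin.revPerm_apply, hrev, hp,
      newtonPoly, Polynomial.eval_prod, Polynomial.eval_sub, Polynomial.eval_X, Polynomial.eval_C]
  have e2 : Matrix.projVandermonde (fun _ : Fin N => (1 : ℝ)) (fun i => x i ^ 2) =
      (Matrix.vandermonde fun i => x i ^ 2).submatrix id Fin.revPerm := by
    ext i j
    simp [Matrix.projVandermonde_apply, Matrix.vandermonde_apply]
  rw [newtonDet, e1, Matrix.det_permute', ← h1, ← Matrix.det_permute', ← e2, h2, vdm]
  simp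

/-! ### Signatures and the action of R^(N) on determinants -/

section Signatures

theorem shifted_strictAnti (lam : GTPlus N) : StrictAnti (shifted lam) := by
  intro i j hij
  have h1 := lam.2 hij.le
  have h2 := i.2
  have h3 := j.2
  have h4 : (i : ℕ) < j := hij
  simp only [shifted]
  omega

theorem shifted_injective : Function.Injective (shifted : GTPlus N → Fin N → ℕ) := by
  intro lam nu h
  ext i
  have := congrFun h i
  simp only [shifted] at this
  omega

theorem add_le_of_strictAnti {f : Fin N → ℕ} (hf : StrictAnti f) :
    ∀ (k : ℕ) (i j : Fin N), (j : ℕ) = i + k → f j + k ≤ f i := by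
  intro k
  induction k with
  | zero => intro i j h; rw [Fin.ext h]; omega
  | succ k ih =>
    intro i j h
    have h1 := ih i ⟨i + k, by omega⟩ rfl
    have h2 : f j < f ⟨i + k, by omega⟩ := hf (show (⟨i + k, by omega⟩ : Fin N) < j by
      rw [Fin.lt_def]; simp only; omega)
    omega

theorem exists_shifted_eq {f : Fin N → ℕ} (hf : StrictAnti f) :
    ∃ nu : GTPlus N, shifted nu = f := by
  -- Guarantees that the truncated subtraction defining the signature is exact.
  have h0 : ∀ i : Fin N, N - 1 - (i : ℕ) ≤ f i := by
    intro i
    have hi := i.2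
    have h1 := add_le_of_strictAnti hf (N - 1 - (i : ℕ)) i ⟨N - 1, by omega⟩
      (show N - 1 = (i : ℕ) + (N - 1 - i) by omega)
    omega
  refine ⟨⟨fun i => f i - (N - 1 - (i : ℕ)), fun i j hij => ?_⟩, ?_⟩
  · have h1 := add_le_of_strictAnti hf ((j : ℕ) - i) i j (by
      have : (i : ℕ) ≤ j := hij
      omega)
    have := h0 i
    have := h0 j
    simp only
    omega
  · ext i
    have := h0 i
    simp only [shifted]
    omega

theorem finite_setOf_le (B : Fin N → ℕ) : {nu : GTPlus N | ∀ i, shifted nu i ≤ B i}.Finite := by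
  refine ((Set.finite_Iic B).preimage Subtype.val_injective.injOn).subset fun nu hnu i => ?_
  have := hnu i
  simp only [shifted] at this
  change nu.1 i ≤ B i
  omega

/-- A finite set containing the support of the row `lam` of the matrix `R^{(N)}`. -/
noncomputable def nbrs (lam : GTPlus N) : Finset (GTPlus N) :=
  (finite_setOf_le fun i => shifted lam i + 1).toFinset

theorem mem_nbrs {lam nu : GTPlus N} :
    nu ∈ nbrs lam ↔ ∀ i, shifted nu i ≤ shifted lam i + 1 := by
  simp [nbrs]

variable {a b : ℝ} {u u' : ℂ}

/-- Each factor is (l_i-l_j)(l_i+l_j+2ε), with both factors at least 1. This lets the denominator be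
dropped in kernel bounds. -/
theorem one_le_vdm_hat (he : 0 ≤ eps a b) (lam : GTPlus N) : 1 ≤ vdm (hat a b lam) := by
  refine Finset.one_le_prod fun i _ => Finset.one_le_prod fun j hj => ?_
  have h1 : shifted lam j + 1 ≤ shifted lam i := shifted_strictAnti lam (Finset.mem_Ioi.1 hj)
  have h2 : (shifted lam j : ℝ) + 1 ≤ shifted lam i := by exact_mod_cast h1
  have h3 : (0 : ℝ) ≤ shifted lam j := Nat.cast_nonneg _
  simp only [hat]
  nlinarith

theorem vdm_hat_pos (he : 0 ≤ eps a b) (lam : GTPlus N) : 0 < vdm (hat a b lam) :=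
  zero_lt_one.trans_le (one_le_vdm_hat he lam)

theorem rateMatrixN_nonneg (hab : b ≤ a) (hb : -(1 / 2) ≤ b) (hu : (u, u') ∈ admissible a b)
    {lam nu : GTPlus N} (h : lam ≠ nu) : 0 ≤ rateMatrixN a b u u' N lam nu := by
  have he := eps_nonneg hab hb
  rw [rateMatrixN, if_neg h, sub_zero]
  refine mul_nonneg (div_nonneg (vdm_hat_pos he nu).le (vdm_hat_pos he lam).le) ?_
  refine Finset.sum_nonneg fun i _ => ?_
  split_ifs with hi
  · refine rateMatrix_nonneg hab hb hu fun hii => h (shifted_injective (funext fun j => ?_))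
    by_cases hj : j = i
    · rw [hj, hii]
    · exact hi j hj
  · exact le_rfl

theorem rateMatrixN_eq_zero {lam nu : GTPlus N} (h : nu ∉ nbrs lam) :
    rateMatrixN a b u u' N lam nu = 0 := by
  have h1 : lam ≠ nu := by
    rintro rfl
    exact h (mem_nbrs.2 fun i => Nat.le_succ _)
  rw [mem_nbrs] at h
  push Not at h
  obtain ⟨i, hi⟩ := h
  rw [rateMatrixN, if_neg h1, Finset.sum_eq_zero, mul_zero, sub_zero]
  intro k _
  split_ifs with hk
  · have hki : i = k := by
      by_contra hik
      have := hk i hik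
      omega
    subst hki
    exact rateMatrix_eq_zero _ _ _ _ (by omega) (by omega) (by omega)
  · rfl

/-- The determinant `det [φ_j (n_i)]`. -/
noncomputable def evalDet (φ : Fin N → ℕ → ℝ) (n : Fin N → ℕ) : ℝ :=
  (Matrix.of fun i j => φ j (n i)).det

theorem evalDet_update (φ : Fin N → ℕ → ℝ) (n : Fin N → ℕ) (i : Fin N) (y : ℕ) :
    evalDet φ (Function.update n i y) =
      ((Matrix.of fun i j => φ j (n i)).updateRow i fun j => φ j y).det := by
  rw [evalDet]
  congr 1
  ext k j
  by_cases hk : k = i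
  · subst hk; simp
  · simp [Matrix.updateRow_ne hk, Function.update_of_ne hk]

/-- The determinant is linear in row i (expressed through `Matrix.cramer`), so the generator passes
inside that row. -/
theorem sum_rateMatrix_mul_evalDet_update (φ : Fin N → ℕ → ℝ) (n : Fin N → ℕ) (i : Fin N) :
    ∑ y ∈ Finset.range (n i + 2), rateMatrix a b u u' (n i) y *
      evalDet φ (Function.update n i y) =
      ((Matrix.of fun i j => φ j (n i)).updateRow i
        fun j => bdGen a b u u' (φ j) (n i)).det := by
  have h1 : (fun j => bdGen a b u u' (φ j) (n i)) =
      ∑ y ∈ Finset.range (n i + 2), rateMatrix a b u u' (n i) y • fun j => φ j y := by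
    ext j
    rw [← sum_rateMatrix_mul, Finset.sum_apply]
    rfl
  rw [h1, ← Matrix.cramer_transpose_apply, map_sum, Finset.sum_apply]
  refine Finset.sum_congr rfl fun y _ => ?_
  rw [map_smul, evalDet_update, Pi.smul_apply, Matrix.cramer_transpose_apply, smul_eq_mul]

/-- The chamber constraint costs nothing: a jump of size at most one breaks the strict order only by
making two coordinates equal, and then the determinant has two equal rows. -/
theorem sum_single_coordinate (φ : Fin N → ℕ → ℝ) (lam : GTPlus N) (i : Fin N) :
    ∑ nu ∈ nbrs lam, (if ∀ j, j ≠ i → shifted lam j = shifted nu j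
        then rateMatrix a b u u' (shifted lam i) (shifted nu i) else 0) *
        evalDet φ (shifted nu) =
      ∑ y ∈ Finset.range (shifted lam i + 2), rateMatrix a b u u' (shifted lam i) y *
        evalDet φ (Function.update (shifted lam) i y) := by
  simp only [ite_mul, zero_mul]
  rw [← Finset.sum_filter]
  have hupd : ∀ nu : GTPlus N, (∀ j, j ≠ i → shifted lam j = shifted nu j) →
      shifted nu = Function.update (shifted lam) i (shifted nu i) := by
    intro nu h
    ext j
    by_cases hj : j = i
    · subst hj; simp
    · rw [Function.update_of_ne hj, h j hj]
  refine Finset.sum_of_injOn (fun nu => shifted nu i) ?_ ?_ ?_ ?_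
  · intro nu hnu mu hmu h
    have h1 := hupd nu (Finset.mem_filter.1 hnu).2
    have h2 := hupd mu (Finset.mem_filter.1 hmu).2
    refine shifted_injective ?_
    rw [h1, h2]
    exact congrArg _ h
  · intro nu hnu
    have := mem_nbrs.1 (Finset.mem_filter.1 hnu).1 i
    simp only [Finset.coe_range, Set.mem_Iio]
    omega
  · intro y _ himg
    by_contra hne
    have hR : rateMatrix a b u u' (shifted lam i) y ≠ 0 := left_ne_zero_of_mul hne
    have hG : evalDet φ (Function.update (shifted lam) i y) ≠ 0 := right_ne_zero_of_mul hne
    have hy : y = shifted lam i + 1 ∨ shifted lam i = y + 1 ∨ shifted lam i = y := by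
      by_contra hcon
      push Not at hcon
      exact hR (rateMatrix_eq_zero _ _ _ _ hcon.1 hcon.2.1 hcon.2.2)
    have hcol : ∀ j, j ≠ i → shifted lam j ≠ y := by
      intro j hj hjy
      refine hG (Matrix.det_zero_of_row_eq hj ?_)
      ext k
      simp [Function.update_of_ne hj, hjy]
    have hanti : StrictAnti (Function.update (shifted lam) i y) := by
      intro p q hpq
      have h1 := shifted_strictAnti lam hpq
      by_cases hp : p = i
      · subst hp
        have h2 := hcol q hpq.ne'
        rw [Function.update_self, Function.update_of_ne hpq.ne']
        omega
      · by_cases hq : q = i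
        · subst hq
          have h2 := hcol p hp
          rw [Function.update_self, Function.update_of_ne hp]
          omega
        · rwa [Function.update_of_ne hp, Function.update_of_ne hq]
    obtain ⟨nu, hnu⟩ := exists_shifted_eq hanti
    refine himg ⟨nu, Finset.mem_coe.2 (Finset.mem_filter.2 ⟨mem_nbrs.2 fun j => ?_, ?_⟩), ?_⟩
    · rw [hnu]
      by_cases hj : j = i
      · subst hj; rw [Function.update_self]; omega
      · rw [Function.update_of_ne hj]; omega
    · intro j hj
      rw [hnu, Function.update_of_ne hj]
    · simp [hnu]
  · intro nu hnu
    rw [← hupd nu (Finset.mem_filter.1 hnu).2]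

/-- The action of `R^{(N)}` on ratios of determinants. -/
theorem sum_rateMatrixN_mul (he : 0 ≤ eps a b) (φ : Fin N → ℕ → ℝ) (lam : GTPlus N) :
    ∑ nu ∈ nbrs lam, rateMatrixN a b u u' N lam nu *
        (evalDet φ (shifted nu) / vdm (hat a b nu)) =
      (∑ i, ((Matrix.of fun i j => φ j (shifted lam i)).updateRow i
          fun j => bdGen a b u u' (φ j) (shifted lam i)).det -
        cConst b u u' N * evalDet φ (shifted lam)) / vdm (hat a b lam) := by
  have hlam : lam ∈ nbrs lam := mem_nbrs.2 fun i => Nat.le_succ _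
  have h1 : ∀ nu, rateMatrixN a b u u' N lam nu *
        (evalDet φ (shifted nu) / vdm (hat a b nu)) =
      (∑ i, (if ∀ j, j ≠ i → shifted lam j = shifted nu j
        then rateMatrix a b u u' (shifted lam i) (shifted nu i) else 0) *
        evalDet φ (shifted nu)) / vdm (hat a b lam) -
      if lam = nu then cConst b u u' N * evalDet φ (shifted lam) / vdm (hat a b lam) else 0 := by
    intro nu
    have hv := (vdm_hat_pos he nu).ne'
    rw [rateMatrixN, sub_mul, ← Finset.sum_mul]
    congr 1
    · field_simp
    · split_ifs with h
      · rw [← h, mul_div_assoc]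
      · rw [zero_mul]
  simp only [h1]
  rw [Finset.sum_sub_distrib, ← Finset.sum_div, Finset.sum_comm, Finset.sum_ite_eq, if_pos hlam,
    sub_div]
  simp only [sum_single_coordinate, sum_rateMatrix_mul_evalDet_update]

end Signatures

/-! ### The Vandermonde eigenfunction and the N-particle Lyapunov function -/

section

variable {N : ℕ} {a b : ℝ} {u u' : ℂ}

/-- The exponents `N - 1, …, 1, 0`. -/
def revDeg (N : ℕ) (j : Fin N) : ℕ := N - 1 - (j : ℕ)

theorem exists_bdGen_newtonPoly (hab : b ≤ a) (hb : -(1 / 2) ≤ b) (u u' : ℂ) :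
    ∃ κ : ℕ → ℝ, κ 0 = 0 ∧ ∀ m x : ℕ,
      bdGen a b u u' (fun x => newtonPoly (eps a b) m (x + eps a b)) x =
        m * (m - 1 - ((u + u').re + b)) * newtonPoly (eps a b) m (x + eps a b) +
          κ m * newtonPoly (eps a b) (m - 1) (x + eps a b) := by
  -- With κ 0 = 0 the truncated degree m - 1 at m = 0 plays no role.
  refine ⟨fun m => if m = 0 then 0 else newtonCoeff a b u u' (m - 1), by simp, fun m x => ?_⟩
  rcases m with _ | m
  · simp [newtonPoly_zero, bdGen_const]
  · rw [bdGen_newtonPoly hab hb]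
    simp

/-- The origin of c_N: it is the sum of the one-particle eigenvalues over the degrees 0, ..., N-1.
-/
theorem sum_eigenvalues (s : ℝ) (N : ℕ) : ∑ j : Fin N, ((revDeg N j : ℕ) : ℝ) *
    (revDeg N j - 1 - s) =
      (N : ℝ) * (N - 1) * (N - 2) / 3 - (N : ℝ) * (N - 1) / 2 * s := by
  have h1 : ∀ N : ℕ, ∑ m ∈ Finset.range N, (m : ℝ) * (m - 1 - s) =
      (N : ℝ) * (N - 1) * (N - 2) / 3 - (N : ℝ) * (N - 1) / 2 * s := by
    intro N
    induction N with
    | zero => simp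
    | succ N ih => rw [Finset.sum_range_succ, ih]; push_cast; ring
  rw [← h1, ← Finset.sum_range_reflect, ← Fin.sum_univ_eq_sum_range
    (fun j => ((N - 1 - j : ℕ) : ℝ) * (((N - 1 - j : ℕ) : ℝ) - 1 - s))]
  rfl

/-- The action of `R^{(N)}` on ratios of Newton determinants. -/
theorem exists_sum_rateMatrixN_newtonDet (hab : b ≤ a) (hb : -(1 / 2) ≤ b) (u u' : ℂ) (N : ℕ) :
    ∃ κ : ℕ → ℝ, κ 0 = 0 ∧ ∀ (d : Fin N → ℕ) (lam : GTPlus N),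
      ∑ nu ∈ nbrs lam, rateMatrixN a b u u' N lam nu *
        (newtonDet (eps a b) d (fun i => shifted nu i + eps a b) / vdm (hat a b nu)) =
      ((∑ j, (d j : ℝ) * (d j - 1 - ((u + u').re + b)) - cConst b u u' N) *
          newtonDet (eps a b) d (fun i => shifted lam i + eps a b) +
        ∑ j, κ (d j) * newtonDet (eps a b) (Function.update d j (d j - 1))
          (fun i => shifted lam i + eps a b)) / vdm (hat a b lam) := by
  obtain ⟨κ, hκ0, hκ⟩ := exists_bdGen_newtonPoly hab hb u u'
  refine ⟨κ, hκ0, fun d lam => ?_⟩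
  have h1 := sum_rateMatrixN_mul (u := u) (u' := u') (eps_nonneg hab hb)
    (fun j x => newtonPoly (eps a b) (d j) (x + eps a b)) lam
  have h2 := sum_det_updateRow_newton (eps a b) d (fun i => (shifted lam i : ℝ) + eps a b)
    (fun i j => bdGen a b u u' (fun x => newtonPoly (eps a b) (d j) (x + eps a b)) (shifted lam i))
    (fun j => (d j : ℝ) * (d j - 1 - ((u + u').re + b))) (fun j => κ (d j)) (fun j => d j - 1)
    (fun i j => hκ (d j) (shifted lam i))
  rw [h2] at h1
  refine h1.trans ?_
  congr 1
  rw [sub_mul]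
  simp only [evalDet, newtonDet]
  ring

/-- The lowered degree coincides with that of the next column. Only degrees from j on are
prescribed, so the leading degree may be changed. -/
theorem newtonDet_update_revDeg_pred (e : ℝ) (x : Fin N → ℝ) {j : Fin N} {d : Fin N → ℕ}
    (hd : ∀ k, j ≤ k → d k = revDeg N k) (hj : d j ≠ 0) :
    newtonDet e (Function.update d j (d j - 1)) x = 0 := by
  have hjN := j.2
  have h1 := hd j le_rfl
  simp only [revDeg] at h1
  have hlt : (j : ℕ) + 1 < N := by omega
  have hne : (⟨j + 1, hlt⟩ : Fin N) ≠ j := by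
    intro h; simpa using congrArg Fin.val h
  refine newtonDet_eq_zero e x hne.symm ?_
  rw [Function.update_self, Function.update_of_ne hne, h1,
    hd ⟨j + 1, hlt⟩ (Fin.le_def.2 (Nat.le_succ _))]
  simp only [revDeg]
  omega

/-- The raised degree coincides with that of the preceding column. -/
theorem newtonDet_update_revDeg_succ (e : ℝ) (x : Fin N → ℝ) {j : Fin N} (hj : (j : ℕ) ≠ 0) :
    newtonDet e (Function.update (revDeg N) j (revDeg N j + 1)) x = 0 := by
  have hjN := j.2
  have hne : (⟨j - 1, by omega⟩ : Fin N) ≠ j := by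
    intro h
    have := congrArg Fin.val h
    simp only at this
    omega
  refine newtonDet_eq_zero e x hne.symm ?_
  rw [Function.update_self, Function.update_of_ne hne]
  simp only [revDeg]
  omega

theorem newtonDet_revDeg (nu : GTPlus N) :
    newtonDet (eps a b) (revDeg N) (fun i => shifted nu i + eps a b) = vdm (hat a b nu) :=
  newtonDet_rev _ _

/-- For degrees N-1, ..., 0 the ratio of determinants is 1, the eigenvalue is cancelled by c_N, and
every lowered determinant vanishes. -/
theorem sum_rateMatrixN (hab : b ≤ a) (hb : -(1 / 2) ≤ b) (u u' : ℂ) (lam : GTPlus N) :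
    ∑ nu ∈ nbrs lam, rateMatrixN a b u u' N lam nu = 0 := by
  obtain ⟨κ, hκ0, hκ⟩ := exists_sum_rateMatrixN_newtonDet hab hb u u' N
  have h1 := hκ (revDeg N) lam
  have hv : ∀ nu : GTPlus N, vdm (hat a b nu) ≠ 0 := fun nu =>
    (vdm_hat_pos (eps_nonneg hab hb) nu).ne'
  simp only [newtonDet_revDeg, div_self (hv _), mul_one] at h1
  rw [h1, sum_eigenvalues, cConst, sub_self, zero_mul, zero_add, Finset.sum_eq_zero, zero_div]
  intro j _
  by_cases hj : revDeg N j = 0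
  · rw [hj, hκ0, zero_mul]
  · rw [newtonDet_update_revDeg_pred _ _ (fun _ _ => rfl) hj, mul_zero]

/-- `∑ x_i²` is, up to an additive constant, a ratio of Newton determinants. -/
theorem sum_sq_mul_newtonDet (hN : 0 < N) (e : ℝ) (x : Fin N → ℝ) :
    (∑ i, x i ^ 2) * newtonDet e (revDeg N) x =
      newtonDet e (Function.update (revDeg N) ⟨0, hN⟩ N) x +
        (∑ j, ((revDeg N j : ℝ) + e) ^ 2) * newtonDet e (revDeg N) x := by
  set M : Matrix (Fin N) (Fin N) ℝ := Matrix.of fun i j => newtonPoly e (revDeg N j) (x i) with hM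
  have h1 := sum_det_updateRow_newton e (revDeg N) x (fun i j => x i ^ 2 * M i j)
    (fun j => ((revDeg N j : ℝ) + e) ^ 2) (fun _ => 1) (fun j => revDeg N j + 1)
    (fun i j => by rw [newtonPoly_succ, hM, Matrix.of_apply]; ring)
  have h2 : ∀ i, (M.updateRow i fun j => x i ^ 2 * M i j).det = x i ^ 2 * M.det := by
    intro i
    have : (fun j => x i ^ 2 * M i j) = x i ^ 2 • M i := rfl
    rw [this, Matrix.det_updateRow_smul, Matrix.updateRow_eq_self]
  rw [← hM] at h1
  simp only [h2, ← Finset.sum_mul] at h1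
  change (∑ i, x i ^ 2) * M.det = _
  rw [h1, add_comm, Finset.sum_eq_single (⟨0, hN⟩ : Fin N)]
  · congr 1
    have : revDeg N ⟨0, hN⟩ + 1 = N := by simp only [revDeg]; omega
    rw [this, one_mul]
  · intro j _ hj
    rw [newtonDet_update_revDeg_succ, mul_zero]
    exact fun h => hj (Fin.ext h)
  · intro h; exact absurd (Finset.mem_univ _) h

/-- The linear function `∑ \hat l_i` is an eigenfunction of `R^{(N)}` up to constants. -/
theorem exists_sum_rateMatrixN_sum_hat (hN : 0 < N) (hab : b ≤ a) (hb : -(1 / 2) ≤ b)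
    (u u' : ℂ) : ∃ A B : ℝ, ∀ lam : GTPlus N,
      ∑ nu ∈ nbrs lam, rateMatrixN a b u u' N lam nu * ∑ i, hat a b nu i =
        A * ∑ i, hat a b lam i + B := by
  obtain ⟨κ, hκ0, hκ⟩ := exists_sum_rateMatrixN_newtonDet hab hb u u' N
  set i₀ : Fin N := ⟨0, hN⟩ with hi₀
  -- Degrees N, N-2, ..., 0: the ratio to the Vandermonde is ∑(l_i+ε)² minus a constant, and only
  -- lowering N to N-1 survives, which restores the Vandermonde.
  set d : Fin N → ℕ := Function.update (revDeg N) i₀ N with hd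
  set k : ℝ := ∑ j, ((revDeg N j : ℝ) + eps a b) ^ 2
  have hv : ∀ nu : GTPlus N, vdm (hat a b nu) ≠ 0 := fun nu =>
    (vdm_hat_pos (eps_nonneg hab hb) nu).ne'
  have hsum : ∀ nu : GTPlus N, newtonDet (eps a b) d (fun i => shifted nu i + eps a b) =
      (∑ i, hat a b nu i - k) * vdm (hat a b nu) := by
    intro nu
    have := sum_sq_mul_newtonDet hN (eps a b) (fun i => (shifted nu i : ℝ) + eps a b)
    rw [newtonDet_revDeg] at this
    rw [sub_mul, eq_sub_iff_add_eq]
    exact this.symm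
  have hlow : ∀ lam : GTPlus N, ∑ j, κ (d j) * newtonDet (eps a b)
      (Function.update d j (d j - 1)) (fun i => shifted lam i + eps a b) =
        κ N * vdm (hat a b lam) := by
    intro lam
    rw [Finset.sum_eq_single i₀]
    · rw [hd, Function.update_self, Function.update_idem]
      have : Function.update (revDeg N) i₀ (N - 1) = revDeg N := by
        have h0 : N - 1 = revDeg N i₀ := by simp [revDeg, hi₀]
        rw [h0, Function.update_eq_self]
      rw [this, newtonDet_revDeg]
    · intro j _ hj
      have hj0 : (j : ℕ) ≠ 0 := fun h => hj (Fin.ext h)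
      by_cases hdj : d j = 0
      · rw [hdj, hκ0, zero_mul]
      · rw [newtonDet_update_revDeg_pred _ _ (fun l hl => ?_) hdj, mul_zero]
        rw [hd, Function.update_of_ne]
        rintro rfl
        exact hj0 (Nat.le_zero.1 hl)
    · intro h; exact absurd (Finset.mem_univ _) h
  set G : ℝ := ∑ j, (d j : ℝ) * (d j - 1 - ((u + u').re + b)) - cConst b u u' N with hG
  refine ⟨G, -G * k + κ N, fun lam => ?_⟩
  have h1 := hκ d lam
  rw [hlow, ← hG] at h1
  simp only [hsum, mul_div_assoc, div_self (hv _), mul_one] at h1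
  simp only [mul_sub, Finset.sum_sub_distrib, ← Finset.sum_mul, sum_rateMatrixN hab hb, zero_mul,
    sub_zero] at h1
  rw [h1]
  have := hv lam
  field_simp
  ring

theorem shifted_le_sum_hat (he : 0 ≤ eps a b) (lam : GTPlus N) (i : Fin N) :
    (shifted lam i : ℝ) ≤ ∑ i, hat a b lam i := by
  refine le_trans ?_ (Finset.single_le_sum (f := hat a b lam) (fun j _ => sq_nonneg _)
    (Finset.mem_univ i))
  have h1 : (shifted lam i : ℝ) ≤ (shifted lam i : ℝ) ^ 2 := by
    exact_mod_cast Nat.le_self_pow two_ne_zero (shifted lam i)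
  have h2 : (0 : ℝ) ≤ shifted lam i := Nat.cast_nonneg _
  simp only [hat]
  nlinarith

theorem hasLyapunov_rateMatrixN (hN : 0 < N) (hab : b ≤ a) (hb : -(1 / 2) ≤ b)
    (hu : (u, u') ∈ admissible a b) : ∃ C, HasLyapunov (rateMatrixN a b u u' N)
      nbrs (fun lam => ∑ i, hat a b lam i + 1) C := by
  have he := eps_nonneg hab hb
  obtain ⟨A, B, hAB⟩ := exists_sum_rateMatrixN_sum_hat hN hab hb u u'
  have h0 : ∀ lam : GTPlus N, 0 ≤ ∑ i, hat a b lam i := fun lam =>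
    Finset.sum_nonneg fun i _ => sq_nonneg _
  refine ⟨|A| + |B|, ?_, ?_, ?_, ?_, ?_, ?_⟩
  · exact fun i j hij => rateMatrixN_nonneg hab hb hu hij
  · exact fun i j hj => rateMatrixN_eq_zero hj
  · exact fun i => sum_rateMatrixN hab hb u u' i
  · intro lam
    linarith [h0 lam]
  · intro c
    refine (finite_setOf_le fun _ => ⌊c⌋₊).subset fun lam hlam i => ?_
    have h1 : ∑ i, hat a b lam i + 1 ≤ c := hlam
    exact Nat.le_floor (by linarith [shifted_le_sum_hat he lam i])
  · intro lam
    simp only [mul_add, mul_one, Finset.sum_add_distrib, sum_rateMatrixN hab hb, hAB, add_zero]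
    have h1 := mul_le_mul_of_nonneg_right (le_abs_self A) (h0 lam)
    have h2 := mul_nonneg (abs_nonneg B) (h0 lam)
    linarith [le_abs_self B, abs_nonneg A]

/-! ### The determinantal kernel -/

/-- The right-hand side of the determinantal formula. -/
noncomputable def detKernel (a b : ℝ) (u u' : ℂ) (P₁ : ℝ≥0 → Matrix ℕ ℕ ℝ) (t : ℝ≥0)
    (lam nu : GTPlus N) : ℝ :=
  Real.exp (-(cConst b u u' N) * (t : ℝ)) * (vdm (hat a b nu) / vdm (hat a b lam)) *
    Matrix.det (Matrix.of fun i j : Fin N => P₁ t (shifted lam i) (shifted nu j))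

/-- Strictly decreasing tuples are determined by their sets of values. If λ ≠ ν, these N-element
sets differ, so some l_i is no n_j and its row vanishes. -/
theorem det_one_shifted (lam nu : GTPlus N) : Matrix.det (Matrix.of fun i j : Fin N =>
    (1 : Matrix ℕ ℕ ℝ) (shifted lam i) (shifted nu j)) = if lam = nu then 1 else 0 := by
  split_ifs with h
  · subst h
    convert Matrix.det_one (n := Fin N) (R := ℝ)
    ext i j
    simp [Matrix.one_apply, (shifted_strictAnti lam).injective.eq_iff]
  · have hr : ¬ Set.range (shifted lam) ⊆ Set.range (shifted nu) := by
      intro hsub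
      have hcard : ∀ mu : GTPlus N, (Set.range (shifted mu)).ncard = N := fun mu => by
        rw [← Set.image_univ, Set.ncard_image_of_injective _ (shifted_strictAnti mu).injective,
          Set.ncard_univ, Nat.card_fin]
      have heq := Set.eq_of_subset_of_ncard_le hsub (by rw [hcard, hcard]) (Set.finite_range _)
      have hrev : ∀ mu : GTPlus N, StrictMono (shifted mu ∘ Fin.rev) := fun mu =>
        (shifted_strictAnti mu).comp Fin.rev_strictAnti
      have h2 := (StrictMono.range_inj (hrev lam) (hrev nu)).1 (by
        rw [Fin.rev_surjective.range_comp, Fin.rev_surjective.range_comp, heq])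
      refine h (shifted_injective (funext fun i => ?_))
      simpa using congrFun h2 (Fin.rev i)
    obtain ⟨_, ⟨i, rfl⟩, hi⟩ := Set.not_subset.1 hr
    refine Matrix.det_eq_zero_of_row_eq_zero i fun j => ?_
    exact Matrix.one_apply_ne fun hij => hi ⟨j, hij.symm⟩

variable {P₁ : ℝ≥0 → Matrix ℕ ℕ ℝ}

theorem detKernel_zero (he : 0 ≤ eps a b) (hP : IsMarkovSemigroup P₁) (lam nu : GTPlus N) :
    detKernel a b u u' P₁ 0 lam nu = (1 : Matrix (GTPlus N) (GTPlus N) ℝ) lam nu := by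
  rw [detKernel, hP.zero, det_one_shifted, Matrix.one_apply]
  split_ifs with h
  · subst h
    simp [div_self (vdm_hat_pos he lam).ne']
  · simp

/-- Differentiating the determinant row by row applies the one-particle generator in each variable,
which is R^(N) conjugated by the Vandermonde; the exponential supplies -c_N. -/
theorem isBackwardSolution_detKernel (he : 0 ≤ eps a b)
    (hP : ∀ j, IsBackwardSolution (rateMatrix a b u u') (fun x => Finset.range (x + 2))
      (fun t i => P₁ t.toNNReal i j)) (nu : GTPlus N) :
    IsBackwardSolution (rateMatrixN a b u u' N) nbrs
      (fun t lam => detKernel a b u u' P₁ t.toNNReal lam nu) := by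
  intro t ht lam
  set c := cConst b u u' N with hc
  set φ : ℝ → Fin N → ℕ → ℝ := fun t j x => P₁ t.toNNReal x (shifted nu j) with hφ
  have hD := hasDerivWithinAt_det (s := Set.Ici 0) (t := t)
    (M := fun t => Matrix.of fun i j => φ t j (shifted lam i))
    (M' := fun i j => bdGen a b u u' (φ t j) (shifted lam i))
    (fun i j => (hP (shifted nu j) t ht (shifted lam i)).congr_deriv
      (sum_rateMatrix_mul a b u u' (φ t j) (shifted lam i)))
  have hE : HasDerivWithinAt (fun t : ℝ => Real.exp (-c * t) * (vdm (hat a b nu) /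
      vdm (hat a b lam))) (-c * Real.exp (-c * t) * (vdm (hat a b nu) / vdm (hat a b lam)))
      (Set.Ici 0) t := by
    refine HasDerivWithinAt.mul_const (HasDerivAt.hasDerivWithinAt ?_) _
    simpa [mul_comm] using ((hasDerivAt_id t).const_mul (-c)).exp
  have hmain := sum_rateMatrixN_mul (u := u) (u' := u') he (φ t) lam
  have hK : ∀ s, 0 ≤ s → ∀ mu : GTPlus N, detKernel a b u u' P₁ s.toNNReal mu nu =
      Real.exp (-c * s) * (vdm (hat a b nu) / vdm (hat a b mu)) *
        evalDet (φ s) (shifted mu) := by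
    intro s hs mu
    rw [detKernel, Real.coe_toNNReal s hs]
    rfl
  have hval : ∑ mu ∈ nbrs lam, rateMatrixN a b u u' N lam mu *
      detKernel a b u u' P₁ t.toNNReal mu nu = Real.exp (-c * t) * vdm (hat a b nu) *
      ∑ mu ∈ nbrs lam, rateMatrixN a b u u' N lam mu *
        (evalDet (φ t) (shifted mu) / vdm (hat a b mu)) := by
    rw [Finset.mul_sum]
    refine Finset.sum_congr rfl fun mu _ => ?_
    rw [hK t ht]
    ring
  have hfin := (hE.mul hD).congr (f₁ := fun s => detKernel a b u u' P₁ s.toNNReal lam nu)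
    (fun s hs => hK s hs lam) (hK t ht lam)
  refine hfin.congr_deriv ?_
  rw [hval, hmain, ← hc]
  simp only [evalDet]
  ring

/-- Used with x = 1 for the boundedness needed in uniqueness, and with the decaying one-particle
bound for the Feller property. -/
theorem abs_detKernel_le (he : 0 ≤ eps a b) (hP : IsMarkovSemigroup P₁) {T : ℝ} {t : ℝ≥0}
    (ht : t ≤ T) (lam nu : GTPlus N) {i : Fin N} {x : ℝ}
    (hx : ∀ j, P₁ t (shifted lam i) (shifted nu j) ≤ x) :
    |detKernel a b u u' P₁ t lam nu| ≤
      Real.exp (|cConst b u u' N| * T) * vdm (hat a b nu) * (N.factorial * x) := by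
  have hdet := abs_det_le_of_row
    (A := Matrix.of fun i j : Fin N => P₁ t (shifted lam i) (shifted nu j))
    (fun i j => hP.abs_le_one _ _ _) (i := i) (x := x)
    (fun j => by simpa [abs_of_nonneg (hP.nonneg _ _ _)] using hx j)
  rw [Fintype.card_fin] at hdet
  have hv1 := one_le_vdm_hat he lam
  have hv := vdm_hat_pos he lam
  have hw := vdm_hat_pos he nu
  have h1 : vdm (hat a b nu) / vdm (hat a b lam) ≤ vdm (hat a b nu) := div_le_self hw.le hv1
  have h2 : Real.exp (-cConst b u u' N * t) ≤ Real.exp (|cConst b u u' N| * T) := by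
    refine Real.exp_le_exp.2 ?_
    exact (mul_le_mul_of_nonneg_right (neg_le_abs _) t.2).trans
      (mul_le_mul_of_nonneg_left ht (abs_nonneg _))
  rw [detKernel, abs_mul, abs_of_pos (mul_pos (Real.exp_pos _) (div_pos hw hv))]
  gcongr

/-- Decay of the entries of the semigroup of the birth-and-death process at infinity. -/
theorem exists_entry_le (hab : b ≤ a) (hb : -(1 / 2) ≤ b) (hu : (u, u') ∈ admissible a b)
    (hM : IsMarkovSemigroup P₁) (hQ : HasQMatrix P₁ (rateMatrix a b u u')) :
    ∃ c : ℝ, ∀ (t : ℝ≥0) (x y : ℕ), P₁ t x y ≤ Real.exp (c * t) *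
      ((((x : ℝ) + eps a b) ^ 2 + 1)⁻¹ * (((y : ℝ) + eps a b) ^ 2 + 1)) := by
  obtain ⟨C, hC⟩ := hasLyapunov_rateMatrix hab hb hu
  obtain ⟨c, hc⟩ := exists_bdGen_inv_le hab hb hu
  refine ⟨c, fun t x y => ?_⟩
  set B : ℝ := ((y : ℝ) + eps a b) ^ 2 + 1 with hB
  have hB0 : 0 < B := by positivity
  have := hC.le_exp_mul (hM.isBackwardSolution hQ hC y)
    (fun T => ⟨1, fun t _ _ i => hM.le_one _ _ _⟩)
    -- The factor B normalises g to 1 at y, so that g dominates the initial indicator of y.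
    (g := fun x : ℕ => (((x : ℝ) + eps a b) ^ 2 + 1)⁻¹ * B) (c := c)
    (fun i => by positivity)
    (fun i => by
      simp only [← mul_assoc, ← Finset.sum_mul]
      rw [sum_rateMatrix_mul a b u u' (fun x : ℕ => (((x : ℝ) + eps a b) ^ 2 + 1)⁻¹)]
      exact mul_le_mul_of_nonneg_right (hc i) hB0.le)
    (fun i => by
      rw [Real.toNNReal_zero, hM.zero, Matrix.one_apply]
      split_ifs with h
      · subst h; rw [hB, inv_mul_cancel₀ (by positivity)]
      · positivity) t.2 x
  simpa using this

/-- The first coordinate is the largest, so only finitely many signatures keep it bounded. -/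
theorem tendsto_inv_shifted (hN : 0 < N) (e : ℝ) : Filter.Tendsto
    (fun lam : GTPlus N => (((shifted lam ⟨0, hN⟩ : ℝ) + e) ^ 2 + 1)⁻¹) Filter.cofinite (𝓝 0) := by
  have h1 : Filter.Tendsto (fun lam : GTPlus N => shifted lam ⟨0, hN⟩) Filter.cofinite
      Filter.atTop := by
    refine Filter.tendsto_atTop.2 fun B => Filter.eventually_cofinite.2 ?_
    refine (finite_setOf_le fun _ => B).subset fun lam hlam i => ?_
    have h2 := (shifted_strictAnti lam).antitone (show (⟨0, hN⟩ : Fin N) ≤ i from Nat.zero_le _)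
    have h3 : ¬ B ≤ shifted lam ⟨0, hN⟩ := hlam
    omega
  have h2 : Filter.Tendsto (fun x : ℕ => ((x : ℝ) + e) ^ 2 + 1) Filter.atTop Filter.atTop := by
    refine Filter.tendsto_atTop_add_const_right _ _ ?_
    exact (Filter.tendsto_pow_atTop two_ne_zero).comp
      (Filter.tendsto_atTop_add_const_right _ _ tendsto_natCast_atTop_atTop)
  exact (tendsto_inv_atTop_zero.comp h2).comp h1

end

end BCGraph

/-! ### Assembly -/

theorem mainTheorem7 (a b : ℝ) (hab : b ≤ a) (hb : -(1 / 2) ≤ b) (u u' : ℂ)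
    (hu : (u, u') ∈ BCGraph.admissible a b) (N : ℕ) (hN : 1 ≤ N) :
    BCGraph.IsNonExplosive (BCGraph.rateMatrixN a b u u' N) ∧
    ∃ (P₁ : ℝ≥0 → Matrix ℕ ℕ ℝ) (P : ℝ≥0 → Matrix (BCGraph.GTPlus N) (BCGraph.GTPlus N) ℝ),
      BCGraph.IsUniqueSemigroupOf P₁ (BCGraph.rateMatrix a b u u') ∧
      BCGraph.IsUniqueSemigroupOf P (BCGraph.rateMatrixN a b u u' N) ∧
      BCGraph.IsFeller P ∧
      ∀ (t : ℝ≥0) (lam nu : BCGraph.GTPlus N),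
        P t lam nu = Real.exp (-(BCGraph.cConst b u u' N) * (t : ℝ)) *
          (BCGraph.vdm (BCGraph.hat a b nu) / BCGraph.vdm (BCGraph.hat a b lam)) *
          Matrix.det (Matrix.of fun i j : Fin N =>
            P₁ t (BCGraph.shifted lam i) (BCGraph.shifted nu j)) := by
  have he := BCGraph.eps_nonneg hab hb
  obtain ⟨C₁, h₁⟩ := BCGraph.hasLyapunov_rateMatrix hab hb hu
  obtain ⟨C, h⟩ := BCGraph.hasLyapunov_rateMatrixN hN hab hb hu
  have hU₁ := h₁.isUniqueSemigroupOf
  have hU := h.isUniqueSemigroupOf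
  set P₁ := BCGraph.minimalSemigroup (BCGraph.rateMatrix a b u u')
  set P := BCGraph.minimalSemigroup (BCGraph.rateMatrixN a b u u' N)
  have hdet : ∀ (t : ℝ≥0) (lam nu : BCGraph.GTPlus N),
      P t lam nu = BCGraph.detKernel a b u u' P₁ t lam nu := by
    intro t lam nu
    have := h.eq_of_isBackwardSolution (hU.1.isBackwardSolution hU.2.1 h nu)
      (BCGraph.isBackwardSolution_detKernel he
        (fun j => hU₁.1.isBackwardSolution hU₁.2.1 h₁ j) nu)
      (fun lam => by rw [Real.toNNReal_zero, BCGraph.detKernel_zero he hU₁.1, hU.1.zero])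
      (fun T => ⟨1, fun t _ _ lam => hU.1.abs_le_one _ _ _⟩)
      (fun T => ⟨_, fun t ht htT lam => BCGraph.abs_detKernel_le he hU₁.1
        (by rwa [Real.coe_toNNReal t ht]) lam nu (i := ⟨0, hN⟩)
        (fun j => hU₁.1.le_one _ _ _)⟩) t t.2 lam
    simpa using this
  refine ⟨h.isNonExplosive, P₁, P, hU₁, hU, hU.1.isFeller fun T nu => ?_, hdet⟩
  obtain ⟨c, hc⟩ := BCGraph.exists_entry_le hab hb hu hU₁.1 hU₁.2.1
  -- Since n_1 is the largest coordinate of ν, k bounds the factor (n_j+ε)²+1 of the entry estimate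
  -- for all j; the decay comes from row l_1.
  set k : ℝ := ((BCGraph.shifted nu ⟨0, hN⟩ : ℝ) + BCGraph.eps a b) ^ 2 + 1
  set g : BCGraph.GTPlus N → ℝ := fun lam =>
    (((BCGraph.shifted lam ⟨0, hN⟩ : ℝ) + BCGraph.eps a b) ^ 2 + 1)⁻¹ with hg
  refine ⟨fun lam => Real.exp (|BCGraph.cConst b u u' N| * T) *
    BCGraph.vdm (BCGraph.hat a b nu) * (N.factorial * (Real.exp (|c| * T) * (g lam * k))), ?_, ?_⟩
  · have := (((BCGraph.tendsto_inv_shifted hN (BCGraph.eps a b)).mul_const k).const_mul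
      (Real.exp (|c| * T))).const_mul (N.factorial : ℝ)
    simpa using this.const_mul (Real.exp (|BCGraph.cConst b u u' N| * T) *
      BCGraph.vdm (BCGraph.hat a b nu))
  · intro t ht lam
    rw [hdet]
    refine (le_abs_self _).trans (BCGraph.abs_detKernel_le he hU₁.1 (NNReal.coe_le_coe.2 ht)
      lam nu (i := ⟨0, hN⟩) fun j => (hc t _ _).trans ?_)
    have h1 : c * t ≤ |c| * T := (mul_le_mul_of_nonneg_right (le_abs_self c) t.2).trans
      (mul_le_mul_of_nonneg_left (NNReal.coe_le_coe.2 ht) (abs_nonneg c))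
    have h2 : (BCGraph.shifted nu j : ℝ) ≤ BCGraph.shifted nu ⟨0, hN⟩ := by
      exact_mod_cast (BCGraph.shifted_strictAnti nu).antitone
        (show (⟨0, hN⟩ : Fin N) ≤ j from Nat.zero_le _)
    have h3 : ((BCGraph.shifted nu j : ℝ) + BCGraph.eps a b) ^ 2 + 1 ≤ k := by
      have : (0 : ℝ) ≤ BCGraph.shifted nu j := Nat.cast_nonneg _
      simp only [k]
      gcongr
    gcongr
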